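/- Let $d,p\ge 1$ and let $\Gamma$ be a splitting crystal group in $\mathbb R^d$: a discrete group of isometries of $\mathbb R^d$ (for the topology of pointwise convergence) that has a compact fundamental domain, and that contains the linear part of each of its elements. A fundamental domain is here a compact set $P$ such that $\bigcup_{\gamma\in\Gamma}\gamma(P)=\mathbb R^d$, the sets $\gamma(P^\circ)$, $\gamma\in\Gamma$, are pairwise disjoint, and $\partial P$ has measure zero. Each $\gamma\in\Gamma$ is written $\gamma=(b,l)$, meaning $\gamma(x)=b(x+l)$ with $b$ linear orthogonal and $l\in\mathbb R^d$. Let $A$ be a real $d\times d$ matrix all of whose complex eigenvalues have modulus greater than $1$ and such that $A\Gamma A^{-1}\subset\Gamma$. Let $f:\mathbb R^d\to\mathbb C^r$ be integrable and compactly supported, and suppose that it satisfies a refinement equation $$f(x)=\sum_{\gamma\in\Gamma} d_\gamma f(\gamma^{-1}Ax)\quad\text{for a.e. }x,$$ with $r\times r$ complex matrices $d_\gamma$, only finitely many of them nonzero. Notation. For $s\ge0$ put $X_{[s]}(x)=[x^\alpha]_{|\alpha|=s}$. For a linear map $T$ of $\mathbb R^d$ and $y\in\mathbb R^d$ the matrices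 $T_{[s]}$ and $Q_{[s,t]}(y)$ are defined by $X_{[s]}(Tx)=T_{[s]}X_{[s]}(x)$ and $X_{[s]}(x-y)=\sum_{t=0}^sQ_{[s,t]}(y)X_{[t]}(x)$. Given row vectors $v_\alpha\in\mathbb C^{1\times r}$ ($|\alpha|<p$), let $v_{[t]}=[v_\alpha]_{|\alpha|=t}$ be the matrix with rows $v_\alpha$, let $y_{[s]}(\gamma)=\sum_{t=0}^sQ_{[s,t]}(l)\,b_{[t]}^{-1}v_{[t]}$ for $\gamma=(b,l)\in\Gamma$, and let $Y_{[s]}=(y_{[s]}(\gamma))_{\gamma\in\Gamma}$. Let $L=[d_{A\gamma A^{-1}\sigma^{-1}}]_{\gamma,\sigma\in\Gamma}$. The translates of $f$ along $\Gamma$ are independent if, for every family of row vectors $(b_\gamma)_{\gamma\in\Gamma}$ in $\mathbb C^{1\times r}$, $\sum_{\gamma\in\Gamma}b_\gamma f(\gamma x)=0$ for a.e. $x$ if and only if all $b_\gamma=0$. The function $f$ has accuracy $p$ if every polynomial $q$ in $d$ variables with $\deg q<p$ belongs to $S(f)$, the closure, for $L^1$-convergence on compact sets, of the space of finite sums $\sum_i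 b_i f(\gamma_i x)$ with $\gamma_i\in\Gamma$ and $b_i\in\mathbb C^{1\times r}$. Consider the statements (I) $f$ has accuracy $p$. (II) There are row vectors $v_\alpha\in\mathbb C^{1\times r}$, $0\le|\alpha|<p$, such that (i) $v_0\hat f(0)\ne0$, where $\hat f(0)=\int_{\mathbb R^d}f$, and (ii) $Y_{[s]}=A_{[s]}Y_{[s]}L$ for $0\le s<p$, that is, $y_{[s]}(\sigma)=A_{[s]}\sum_{\gamma\in\Gamma}y_{[s]}(\gamma)\,d_{A\gamma A^{-1}\sigma^{-1}}$ for all $\sigma\in\Gamma$. Then: (a) If the translates of $f$ along $\Gamma$ are independent, then (I) implies (II). (b) (II) implies (I). Moreover, for any row vectors $v_\alpha$ as in (II) and any fundamental domain $P$ of $\Gamma$, if all the $v_\alpha$ are multiplied by $C=(v_0\hat f(0))^{-1}|P|$, then with the resulting $y_{[s]}$, $$X_{[s]}(x)=\sum_{\gamma\in\Gamma}y_{[s]}(\gamma)f(\gamma x)\quad\text{for a.e. }x,\qquad 0\le s<p.$$ -/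

import Mathlib

open MeasureTheory
open scoped Matrix FourierTransform ENNReal

namespace CrystalAccuracy

/-- The Euclidean space `ℝ^d`. -/
abbrev Euc (d : ℕ) : Type := EuclideanSpace ℝ (Fin d)

/-- The group of invertible affine maps of `ℝ^d` (product = composition). The isometries of `ℝ^d`
are exactly its elements that preserve distances. -/
abbrev Aff (d : ℕ) : Type := Euc d ≃ᵃ[ℝ] Euc d

/-! ### Crystal groups -/

/-- A compact fundamental domain: the images `γ(P)` cover `ℝ^d`, the images of the interior of `P`
under different elements of `Γ` are disjoint, and the boundary of `P` is a null set (so that the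
measure of `P` does not depend on `P`). -/
structure IsFundDomain {d : ℕ} (Γ : Subgroup (Aff d)) (P : Set (Euc d)) : Prop where
  isCompact : IsCompact P
  covers : ∀ x : Euc d, ∃ γ ∈ Γ, x ∈ γ '' P
  tiles : ∀ γ ∈ Γ, ∀ γ' ∈ Γ, ((γ '' interior P) ∩ (γ' '' interior P)).Nonempty → γ = γ'
  frontier_null : volume (frontier P) = 0

/-- A crystal group: a group of isometries of `ℝ^d`, discrete for the topology of pointwise
convergence, which has a compact fundamental domain. -/
structure IsCrystalGroup {d : ℕ} (Γ : Subgroup (Aff d)) : Prop where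
  isometry : ∀ γ ∈ Γ, Isometry γ
  discrete : IsDiscrete ((fun γ : Aff d => (γ : Euc d → Euc d)) '' (Γ : Set (Aff d)))
  exists_fundDomain : ∃ P : Set (Euc d), IsFundDomain Γ P

/-- A splitting crystal group. The point group of `Γ` consists of the linear parts of its elements;
`Γ` splits when the point group is contained in `Γ`, so that `Γ` is the semidirect product of the
point group and the translations in `Γ`: it consists of all maps `x ↦ b (x + l)` with `b` in the
point group and `l` in the lattice of `Γ`. -/
structure IsSplittingCrystalGroup {d : ℕ} (Γ : Subgroup (Aff d)) : Prop
    extends IsCrystalGroup Γ where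
  splits : ∀ γ ∈ Γ, γ.linear.toAffineEquiv ∈ Γ

/-- The linear part `b` of `γ = (b, l)`, where `γ x = b (x + l)`. -/
noncomputable def linPart {d : ℕ} (γ : Aff d) : Euc d →ₗ[ℝ] Euc d := γ.linear.toLinearMap

/-- The vector `l` of `γ = (b, l)`, where `γ x = b (x + l)`. -/
noncomputable def latPart {d : ℕ} (γ : Aff d) : Euc d := γ.linear.symm (γ 0)

theorem apply_eq {d : ℕ} (γ : Aff d) (x : Euc d) : γ x = linPart γ (x + latPart γ) := by
  have h := γ.map_vadd 0 x
  simp only [vadd_eq_add, add_zero] at h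
  simp [linPart, latPart, h]

/-- A linear map is expansive when all its complex eigenvalues have modulus greater than one. -/
def IsExpansive {d : ℕ} (A : Euc d →ₗ[ℝ] Euc d) : Prop :=
  ∀ μ : ℂ, Polynomial.aeval μ A.charpoly = 0 → 1 < ‖μ‖

/-- `A` is `Γ`-admissible: `A` is expansive and `A Γ A⁻¹ ⊆ Γ`. -/
structure IsAdmissible {d : ℕ} (Γ : Subgroup (Aff d)) (A : Euc d ≃ₗ[ℝ] Euc d) : Prop where
  expansive : IsExpansive A.toLinearMap
  conj_mem : ∀ γ ∈ Γ, A.toAffineEquiv * γ * A.toAffineEquiv⁻¹ ∈ Γ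

/-! ### Multi-indices, monomials, and the matrices attached to them -/

/-- The multi-indices of degree `s` in `d` variables. -/
abbrev MultiIdx (d s : ℕ) : Type := {α : Fin d →₀ ℕ // α.degree = s}

noncomputable instance instFintypeMultiIdx (d s : ℕ) : Fintype (MultiIdx d s) :=
  Fintype.subtype (Finset.finsuppAntidiag Finset.univ s)
    (fun α => by simp [Finset.mem_finsuppAntidiag, Finsupp.degree_eq_sum])

/-- The vector `X_[s](x) = [x^α]_{|α| = s}`. -/
noncomputable def monoVec {d : ℕ} (s : ℕ) (x : Euc d) : MultiIdx d s → ℂ :=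
  fun α => ∏ i, ((x i : ℝ) : ℂ) ^ (α.1 i)

/-- The polynomial which is the `i`-th coordinate of `T x`. -/
noncomputable def coordPoly {d : ℕ} (T : Euc d →ₗ[ℝ] Euc d) (i : Fin d) :
    MvPolynomial (Fin d) ℂ :=
  ∑ j, MvPolynomial.C ((T (EuclideanSpace.single j 1) i : ℝ) : ℂ) * MvPolynomial.X j

/-- The matrix `T_[s]`, with `X_[s](T x) = T_[s] X_[s](x)`: its row `α` lists the coefficients of
the polynomial `(T x)^α`. -/
noncomputable def powMat {d : ℕ} (T : Euc d →ₗ[ℝ] Euc d) (s : ℕ) :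
    Matrix (MultiIdx d s) (MultiIdx d s) ℂ :=
  Matrix.of fun α β => MvPolynomial.coeff β.1 (∏ i, coordPoly T i ^ (α.1 i))

/-- The matrix `Q_[s,t](y)`, with `X_[s](x - y) = ∑_{t ≤ s} Q_[s,t](y) X_[t](x)`: its row `α` lists
the coefficients of degree `t` of the polynomial `(x - y)^α`. -/
noncomputable def shiftMat {d : ℕ} (s t : ℕ) (y : Euc d) :
    Matrix (MultiIdx d s) (MultiIdx d t) ℂ :=
  Matrix.of fun α β => MvPolynomial.coeff β.1
    (∏ i, (MvPolynomial.X i - MvPolynomial.C ((y i : ℝ) : ℂ)) ^ (α.1 i))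

/-- The matrix `Q̃_[s,t](γ) = Q_[s,t](l) b_[t]⁻¹` for `γ = (b, l)`. -/
noncomputable def crystalMat {d : ℕ} (s t : ℕ) (γ : Aff d) :
    Matrix (MultiIdx d s) (MultiIdx d t) ℂ :=
  shiftMat s t (latPart γ) * (powMat (linPart γ) t)⁻¹

theorem eval_coordPoly {d : ℕ} (T : Euc d →ₗ[ℝ] Euc d) (i : Fin d) (x : Euc d) :
    MvPolynomial.eval (fun j => ((x j : ℝ) : ℂ)) (coordPoly T i) = ((T x i : ℝ) : ℂ) := by
  have hx : x = ∑ j, x j • EuclideanSpace.single j (1 : ℝ) := by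
    ext k
    simp [Pi.single_apply]
  conv_rhs => rw [hx]
  simp [coordPoly, mul_comm]

theorem eval_eq_sum_monoVec {d : ℕ} (q : MvPolynomial (Fin d) ℂ) (s : ℕ) (hq : q.totalDegree ≤ s)
    (x : Euc d) :
    MvPolynomial.eval (fun j => ((x j : ℝ) : ℂ)) q =
      ∑ t ∈ Finset.range (s + 1), ∑ β : MultiIdx d t,
        MvPolynomial.coeff β.1 q * monoVec t x β := by
  have h1 : ∀ t, ∑ β : MultiIdx d t, MvPolynomial.coeff β.1 q * monoVec t x β =
      ∑ β ∈ q.support with β.degree = t,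
        MvPolynomial.coeff β q * ∏ i, ((x i : ℝ) : ℂ) ^ (β i) := by
    intro t
    symm
    refine Finset.sum_bij_ne_zero (fun β hβ _ => (⟨β, (Finset.mem_filter.1 hβ).2⟩ : MultiIdx d t))
      (fun _ _ _ => Finset.mem_univ _) ?_ ?_ ?_
    · intro a _ _ b _ _ h
      exact congrArg Subtype.val h
    · intro β _ hβ
      refine ⟨β.1, Finset.mem_filter.2 ⟨?_, β.2⟩, hβ, rfl⟩
      rw [MvPolynomial.mem_support_iff]
      exact left_ne_zero_of_mul hβ
    · intro a _ _
      rfl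
  rw [MvPolynomial.eval_eq', Finset.sum_congr rfl (fun t _ => h1 t)]
  symm
  refine Finset.sum_fiberwise_of_maps_to (fun β hβ => ?_) _
  rw [Finset.mem_range, Nat.lt_succ_iff]
  exact (MvPolynomial.le_totalDegree hβ).trans hq

/-- The defining property of `T_[s]`. -/
theorem monoVec_map {d : ℕ} (T : Euc d →ₗ[ℝ] Euc d) (s : ℕ) (x : Euc d) :
    monoVec s (T x) = powMat T s *ᵥ monoVec s x := by
  funext α
  have hom : (∏ i, coordPoly T i ^ (α.1 i)).IsHomogeneous s := by
    have := MvPolynomial.IsHomogeneous.prod Finset.univ (fun i => coordPoly T i ^ (α.1 i))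
      (fun i => 1 * α.1 i) (fun i _ => MvPolynomial.IsHomogeneous.pow
        (MvPolynomial.IsHomogeneous.sum _ _ _ fun j _ => by
          simpa using (MvPolynomial.isHomogeneous_C (Fin d) _).mul
            (MvPolynomial.isHomogeneous_X ℂ j)) _)
    simp only [one_mul] at this
    rwa [← Finsupp.degree_eq_sum, α.2] at this
  have e := eval_eq_sum_monoVec _ s hom.totalDegree_le x
  rw [Finset.sum_range_succ, Finset.sum_eq_zero, zero_add] at e
  · simpa [eval_coordPoly, monoVec, powMat, Matrix.mulVec, dotProduct, map_prod] using e
  · intro t ht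
    refine Finset.sum_eq_zero fun β _ => ?_
    rw [hom.coeff_eq_zero, zero_mul]
    rw [β.2]
    exact (Finset.mem_range.1 ht).ne

/-- The defining property of `Q_[s,t]`. -/
theorem monoVec_sub {d : ℕ} (s : ℕ) (x y : Euc d) :
    monoVec s (x - y) = ∑ t ∈ Finset.range (s + 1), shiftMat s t y *ᵥ monoVec t x := by
  funext α
  have hdeg : (∏ i, ((MvPolynomial.X i : MvPolynomial (Fin d) ℂ)
      - MvPolynomial.C ((y i : ℝ) : ℂ)) ^ (α.1 i)).totalDegree ≤ s := by
    refine (MvPolynomial.totalDegree_finsetProd _ _).trans ?_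
    refine le_of_le_of_eq ?_ ((Finsupp.degree_eq_sum α.1).symm.trans α.2)
    refine Finset.sum_le_sum fun i _ => (MvPolynomial.totalDegree_pow _ _).trans ?_
    have : ((MvPolynomial.X i : MvPolynomial (Fin d) ℂ)
        - MvPolynomial.C ((y i : ℝ) : ℂ)).totalDegree ≤ 1 :=
      (MvPolynomial.totalDegree_sub _ _).trans (by simp)
    nlinarith
  have e := eval_eq_sum_monoVec _ s hdeg x
  simpa [monoVec, shiftMat, Matrix.mulVec, dotProduct, map_prod, Finset.sum_apply] using e

/-! ### The functions `y_[s]` -/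

/-- The matrix `y_[s](γ) = ∑_{t ≤ s} Q̃_[s,t](γ) v_[t]`, where `v_[t] = [v_α]_{|α| = t}` has the
row vectors `v_α` as its rows. -/
noncomputable def yMat {d r : ℕ} (v : (Fin d →₀ ℕ) → Fin r → ℂ) (s : ℕ) (γ : Aff d) :
    Matrix (MultiIdx d s) (Fin r) ℂ :=
  ∑ t ∈ Finset.range (s + 1),
    crystalMat s t γ * Matrix.of (fun α : MultiIdx d t => v α.1)

/-! ### Refinable functions, independence, accuracy -/

/-- The refinement equation `f(x) = ∑_γ c_γ f(γ⁻¹ (A x))` for almost every `x`, with finitely many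
nonzero `r × r` coefficient matrices `c_γ`, all of them with `γ ∈ Γ`. -/
structure IsRefinable {d r : ℕ} (Γ : Subgroup (Aff d)) (A : Euc d ≃ₗ[ℝ] Euc d)
    (c : Aff d →₀ Matrix (Fin r) (Fin r) ℂ) (f : Euc d → Fin r → ℂ) : Prop where
  support_subset : ∀ γ ∈ c.support, γ ∈ Γ
  refinement : ∀ᵐ x : Euc d, f x = ∑ γ ∈ c.support, c γ *ᵥ f (γ⁻¹ (A x))

/-- The block `c_{A γ A⁻¹ σ⁻¹}` in position `(γ, σ)` of the infinite matrix `L`. -/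
noncomputable def refMat {d r : ℕ} (A : Euc d ≃ₗ[ℝ] Euc d)
    (c : Aff d →₀ Matrix (Fin r) (Fin r) ℂ) (γ σ : Aff d) : Matrix (Fin r) (Fin r) ℂ :=
  c (A.toAffineEquiv * γ * A.toAffineEquiv⁻¹ * σ⁻¹)

/-- The translates of `f` along `Γ` are independent: for arbitrary (not necessarily finitely
supported) row vectors `b_γ`, the function `∑_γ b_γ f(γ x)` vanishes almost everywhere only if all
`b_γ` vanish. For compactly supported `f` the sum is finite at every `x`. -/
def IndependentTranslates {d r : ℕ} (Γ : Subgroup (Aff d)) (f : Euc d → Fin r → ℂ) : Prop :=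
  ∀ b : Γ → Fin r → ℂ,
    (∀ᵐ x : Euc d, ∑ᶠ γ : Γ, b γ ⬝ᵥ f (γ.1 x) = 0) ↔ ∀ γ, b γ = 0

/-- The finite linear combinations `∑ b_γ f(γ x)`, with row vectors `b_γ` as coefficients. -/
def finiteSpan {d r : ℕ} (Γ : Subgroup (Aff d)) (f : Euc d → Fin r → ℂ) :
    Submodule ℂ (Euc d → ℂ) :=
  Submodule.span ℂ {h | ∃ γ ∈ Γ, ∃ b : Fin r → ℂ, h = fun x => b ⬝ᵥ f (γ x)}

/-- Membership in `S(f)`, the closure of the space of finite linear combinations of the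
`Γ`-translates of `f` for convergence in `L¹` on compact sets. -/
def MemS {d r : ℕ} (Γ : Subgroup (Aff d)) (f : Euc d → Fin r → ℂ) (g : Euc d → ℂ) : Prop :=
  ∀ K : Set (Euc d), IsCompact K → ∀ ε : ℝ≥0∞, 0 < ε →
    ∃ h ∈ finiteSpan Γ f, ∫⁻ x in K, ‖g x - h x‖ₑ < ε

/-- `f` has accuracy (at least) `p`: every polynomial of degree less than `p` is in `S(f)`. -/
def HasAccuracy {d r : ℕ} (Γ : Subgroup (Aff d)) (f : Euc d → Fin r → ℂ) (p : ℕ) : Prop :=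
  ∀ q : MvPolynomial (Fin d) ℂ, q.totalDegree < p →
    MemS Γ f (fun x => MvPolynomial.eval (fun i => ((x i : ℝ) : ℂ)) q)

/-- The conditions on the row vectors `v_α`: (i) `v_0 f̂(0) ≠ 0` and (ii) `Y_[s] = A_[s] Y_[s] L` for
`s < p`, written out blockwise. Only the `v_α` with `|α| < p` occur (for `0 < p`). The sum has
finitely many nonzero terms. -/
structure AccuracyCondition {d r : ℕ} (Γ : Subgroup (Aff d)) (A : Euc d ≃ₗ[ℝ] Euc d)
    (c : Aff d →₀ Matrix (Fin r) (Fin r) ℂ) (f : Euc d → Fin r → ℂ) (p : ℕ)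
    (v : (Fin d →₀ ℕ) → Fin r → ℂ) : Prop where
  nonzero : v 0 ⬝ᵥ 𝓕 f 0 ≠ 0
  eigen : ∀ s < p, ∀ σ : Γ,
    yMat v s σ.1 = powMat A.toLinearMap s * ∑ᶠ γ : Γ, yMat v s γ.1 * refMat A c γ.1 σ.1

end CrystalAccuracy

namespace CrystalAccuracy

/-! ### Independence of the monomials and the cocycle identity -/

/-! Write `G_[s](x) = ∑_γ y_[s](γ) f(γ x)` (`accVec`). The proof compares two transformation laws of
`G_[s]` with those of the monomial vector `X_[s]`.

The matrices `Q̃_[s,t](γ)` express `X_[s](γ⁻¹ x)` through the `X_[t](x)`, so they form a cocycle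
(`crystalMat_mul`). Hence `y_[s](γσ) = ∑_t Q̃_[s,t](σ) y_[t](γ)`, and `G` obeys the same law as `X`
under `Γ` (`accVec_inv_apply`). The refinement equation reads `F(x) = L F(A x)` for the vector `F`
of all translates (`translateSum_refine`), so `Y_[s] = A_[s] Y_[s] L` gives `G_[s](A x) = A_[s]
G_[s](x)`, again as for `X` (`accVec_scale`).

For (b), induct on `s`. If `G_[t] = X_[t]` for `t < s`, then `H = G_[s] - X_[s]` is periodic under
the lattice of `Γ`, and by the scaling law under all its images by `A⁻ⁿ`. These periods are dense
because `A` is expansive, so `H` is a.e. a constant `u` (`ae_const_of_equivariant`) with `A_[s] u =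
u`. For `s > 0` the eigenvalue `1` is excluded, so `u = 0`; for `s = 0` the integral over a
fundamental domain fixes the constant (`accVec_ae_eq_monoVec`).

For (a), a duality argument shows that each locally integrable function in `S(f)` is a.e. an
infinite combination of translates (`exists_translateSum_eq`). Independence makes its coefficients
unique, so both laws pass from the monomials to the coefficients: the `Γ`-law forces the form
`y_[s]`, with the `v_α` read off at `γ = 1`, and the scaling law becomes `Y_[s] = A_[s] Y_[s] L`. -/

theorem monoVec_independent {d N : ℕ} (w : ∀ t, MultiIdx d t → ℂ)
    (h : ∀ x : Euc d, ∑ t ∈ Finset.range N, w t ⬝ᵥ monoVec t x = 0) : ∀ t < N, w t = 0 := by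
  set q : MvPolynomial (Fin d) ℂ :=
    ∑ t ∈ Finset.range N, ∑ β : MultiIdx d t, MvPolynomial.monomial β.1 (w t β) with hq
  have hq0 : q = 0 := by
    -- A complex polynomial vanishing on `ℝ^d`, a product of infinite subsets of `ℂ`, is zero.
    refine MvPolynomial.funext_set (fun _ => Set.range ((↑) : ℝ → ℂ))
      (fun _ => Set.infinite_range_of_injective Complex.ofReal_injective) fun x hx => ?_
    have hx' : ∀ i, ∃ y : ℝ, (y : ℂ) = x i := fun i => hx i (Set.mem_univ i)
    choose y hy using hx'
    have := h (WithLp.toLp 2 y)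
    rw [map_zero, ← this, hq, map_sum]
    refine Finset.sum_congr rfl fun t _ => ?_
    rw [map_sum]
    refine Finset.sum_congr rfl fun β _ => ?_
    rw [MvPolynomial.eval_monomial, Finsupp.prod_fintype _ _ (by simp)]
    simp [monoVec, hy]
  intro t ht
  funext β
  have := congrArg (MvPolynomial.coeff β.1) hq0
  rw [hq, MvPolynomial.coeff_sum, Finset.sum_eq_single t, MvPolynomial.coeff_sum,
    Finset.sum_eq_single β] at this
  · simpa using this
  · intro b _ hb
    rw [MvPolynomial.coeff_monomial, if_neg (fun e => hb (Subtype.ext e))]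
  · simp
  · intro b _ hb
    rw [MvPolynomial.coeff_sum]
    refine Finset.sum_eq_zero fun γ _ => ?_
    rw [MvPolynomial.coeff_monomial, if_neg]
    intro e
    exact hb (by rw [← γ.2, ← β.2, e])
  · intro h'
    exact absurd (Finset.mem_range.2 ht) h'

theorem matrix_eq_of_monoVec {d N : ℕ} {m : Type*} (M M' : ∀ t, Matrix m (MultiIdx d t) ℂ)
    (h : ∀ x : Euc d, ∑ t ∈ Finset.range N, M t *ᵥ monoVec t x =
      ∑ t ∈ Finset.range N, M' t *ᵥ monoVec t x) : ∀ t < N, M t = M' t := by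
  intro t ht
  ext i β
  have := monoVec_independent (N := N) (fun t β => M t i β - M' t i β) (fun x => by
    have := congrFun (h x) i
    simp only [Finset.sum_apply, Matrix.mulVec, dotProduct] at this
    simp only [dotProduct, sub_mul, Finset.sum_sub_distrib, this, sub_self]) t ht
  simpa [sub_eq_zero] using congrFun this β

theorem matrix_eq_of_monoVec' {d s : ℕ} {m : Type*} (M M' : Matrix m (MultiIdx d s) ℂ)
    (h : ∀ x : Euc d, M *ᵥ monoVec s x = M' *ᵥ monoVec s x) : M = M' := by
  classical
  have := matrix_eq_of_monoVec (N := s + 1)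
    (fun t => if h : s = t then h ▸ M else 0) (fun t => if h : s = t then h ▸ M' else 0)
    (fun x => by
      rw [Finset.sum_eq_single s, Finset.sum_eq_single s]
      · simpa using h x
      · intro t _ ht; simp [ht.symm]
      · simp
      · intro t _ ht; simp [ht.symm]
      · simp) s (Nat.lt_succ_self s)
  simpa using this

theorem powMat_mul_powMat {d : ℕ} (s : ℕ) (S T : Euc d →ₗ[ℝ] Euc d) :
    powMat S s * powMat T s = powMat (S ∘ₗ T) s := by
  refine matrix_eq_of_monoVec' _ _ fun x => ?_
  rw [← Matrix.mulVec_mulVec, ← monoVec_map, ← monoVec_map, ← monoVec_map]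
  rfl

theorem powMat_id {d : ℕ} (s : ℕ) : powMat (LinearMap.id : Euc d →ₗ[ℝ] Euc d) s = 1 := by
  refine matrix_eq_of_monoVec' _ _ fun x => ?_
  rw [← monoVec_map, Matrix.one_mulVec]
  rfl

theorem powMat_inv {d : ℕ} (s : ℕ) (T : Euc d ≃ₗ[ℝ] Euc d) :
    (powMat T.toLinearMap s)⁻¹ = powMat T.symm.toLinearMap s := by
  refine Matrix.inv_eq_right_inv ?_
  rw [powMat_mul_powMat, ← powMat_id]
  congr 1
  ext x : 1
  simp

theorem inv_apply_eq {d : ℕ} (γ : Aff d) (x : Euc d) :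
    γ⁻¹ x = γ.linear.symm x - latPart γ := by
  apply γ.injective
  rw [apply_eq γ (γ.linear.symm x - latPart γ), sub_add_cancel]
  change (γ * γ⁻¹) x = _
  simp [linPart]

theorem shiftMat_eq_zero {d s t : ℕ} (h : s < t) (y : Euc d) : shiftMat s t y = 0 := by
  ext α β
  refine MvPolynomial.coeff_eq_zero_of_totalDegree_lt ?_
  refine lt_of_le_of_lt ?_ (h.trans_eq (β.2.symm.trans (by
    rw [Finsupp.degree_apply])))
  refine (MvPolynomial.totalDegree_finsetProd _ _).trans ?_
  refine le_of_le_of_eq ?_ ((Finsupp.degree_eq_sum α.1).symm.trans α.2)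
  refine Finset.sum_le_sum fun i _ => (MvPolynomial.totalDegree_pow _ _).trans ?_
  have : ((MvPolynomial.X i : MvPolynomial (Fin d) ℂ)
      - MvPolynomial.C ((y i : ℝ) : ℂ)).totalDegree ≤ 1 :=
    (MvPolynomial.totalDegree_sub _ _).trans (by simp)
  nlinarith

theorem crystalMat_eq_zero {d s t : ℕ} (h : s < t) (γ : Aff d) : crystalMat s t γ = 0 := by
  rw [crystalMat, shiftMat_eq_zero h, Matrix.zero_mul]

/-- The blocks with `t > s` vanish, so triangular sums of varying length can all be written over the
common range `p` and then interchanged freely. -/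
theorem sum_range_eq_of_le {M : Type*} [AddCommMonoid M] {s p : ℕ} (hs : s < p) (g : ℕ → M)
    (hg : ∀ t, s < t → g t = 0) :
    ∑ t ∈ Finset.range (s + 1), g t = ∑ t ∈ Finset.range p, g t := by
  refine Finset.sum_subset (Finset.range_mono hs) fun t _ ht => hg t ?_
  rw [Finset.mem_range] at ht
  omega

theorem monoVec_inv_apply {d s p : ℕ} (hs : s < p) (γ : Aff d) (x : Euc d) :
    monoVec s (γ⁻¹ x) = ∑ t ∈ Finset.range p, crystalMat s t γ *ᵥ monoVec t x := by
  rw [← sum_range_eq_of_le hs _ (fun t ht => by rw [crystalMat_eq_zero ht, Matrix.zero_mulVec]),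
    inv_apply_eq, monoVec_sub]
  refine Finset.sum_congr rfl fun t _ => ?_
  rw [crystalMat, ← Matrix.mulVec_mulVec]
  congr 1
  have := monoVec_map γ.linear.symm.toLinearMap t x
  rw [linPart, powMat_inv, ← this]
  rfl

/-- Expand `X_[s]((γσ)⁻¹ x) = X_[s](σ⁻¹ (γ⁻¹ x))` in two ways and compare coefficients; the
inversion is what reverses the order of the factors. -/
theorem crystalMat_mul {d s t p : ℕ} (hs : s < p) (ht : t < p) (γ σ : Aff d) :
    crystalMat s t (γ * σ) =
      ∑ u ∈ Finset.range p, crystalMat s u σ * crystalMat u t γ := by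
  refine matrix_eq_of_monoVec (N := p) (fun t => crystalMat s t (γ * σ))
    (fun t => ∑ u ∈ Finset.range p, crystalMat s u σ * crystalMat u t γ) (fun x => ?_) t ht
  rw [← monoVec_inv_apply hs, mul_inv_rev]
  change monoVec s (σ⁻¹ (γ⁻¹ x)) = _
  rw [monoVec_inv_apply hs]
  simp_rw [Matrix.sum_mulVec, ← Matrix.mulVec_mulVec]
  rw [Finset.sum_comm]
  refine Finset.sum_congr rfl fun u hu => ?_
  rw [monoVec_inv_apply (Finset.mem_range.1 hu), Matrix.mulVec_sum]

theorem yMat_eq_sum {d r s p : ℕ} (hs : s < p) (v : (Fin d →₀ ℕ) → Fin r → ℂ) (γ : Aff d) :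
    yMat v s γ = ∑ t ∈ Finset.range p,
      crystalMat s t γ * Matrix.of (fun α : MultiIdx d t => v α.1) :=
  sum_range_eq_of_le hs _ fun t ht => by rw [crystalMat_eq_zero ht, Matrix.zero_mul]

theorem yMat_mul {d r s p : ℕ} (hs : s < p) (v : (Fin d →₀ ℕ) → Fin r → ℂ) (γ σ : Aff d) :
    yMat v s (γ * σ) = ∑ t ∈ Finset.range p, crystalMat s t σ * yMat v t γ := by
  rw [yMat_eq_sum hs]
  rw [Finset.sum_congr rfl (g := fun t => ∑ u ∈ Finset.range p, crystalMat s u σ *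
    (crystalMat u t γ * Matrix.of (fun α : MultiIdx d t => v α.1)))]
  · rw [Finset.sum_comm]
    refine Finset.sum_congr rfl fun u hu => ?_
    rw [yMat_eq_sum (Finset.mem_range.1 hu), Matrix.mul_sum]
  · intro t ht
    rw [crystalMat_mul hs (Finset.mem_range.1 ht), Matrix.sum_mul]
    simp_rw [Matrix.mul_assoc]

theorem yMat_smul {d r s : ℕ} (C : ℂ) (v : (Fin d →₀ ℕ) → Fin r → ℂ) (γ : Aff d) :
    yMat (fun α => C • v α) s γ = C • yMat v s γ := by
  rw [yMat, yMat, Finset.smul_sum]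
  refine Finset.sum_congr rfl fun t _ => ?_
  rw [← Matrix.mul_smul]
  rfl

/-! ### Homogeneity and the diagonal blocks -/

theorem continuous_monoVec {d : ℕ} (s : ℕ) : Continuous (monoVec (d := d) s) := by
  unfold monoVec
  fun_prop

theorem monoVec_smul {d : ℕ} (s : ℕ) (ε : ℝ) (x : Euc d) :
    monoVec s (ε • x) = (ε : ℂ) ^ s • monoVec s x := by
  funext α
  simp only [monoVec, PiLp.smul_apply, smul_eq_mul, Complex.ofReal_mul, mul_pow,
    Finset.prod_mul_distrib, Pi.smul_apply, Finset.prod_pow_eq_pow_sum]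
  rw [← Finsupp.degree_eq_sum, α.2]

theorem shiftMat_self {d : ℕ} (s : ℕ) (y : Euc d) : shiftMat s s y = 1 := by
  refine matrix_eq_of_monoVec' _ _ fun x => ?_
  -- For `ε ≠ 0`, write `x - ε y = ε (ε⁻¹ x - y)` and use homogeneity. Both sides are continuous in
  -- `ε`, and at `ε = 0` only the term `t = s` survives.
  have key : (fun ε : ℝ => monoVec s (x - ε • y)) = fun ε : ℝ =>
      ∑ t ∈ Finset.range (s + 1), (ε : ℂ) ^ (s - t) • (shiftMat s t y *ᵥ monoVec t x) := by
    refine Continuous.ext_on (dense_compl_singleton (0 : ℝ)) ?_ ?_ ?_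
    · exact (continuous_monoVec s).comp (by fun_prop)
    · fun_prop
    · intro ε hε
      have hε : (ε : ℝ) ≠ 0 := hε
      have e : x - ε • y = ε • (ε⁻¹ • x - y) := by
        rw [smul_sub, smul_inv_smul₀ hε]
      dsimp only
      rw [e, monoVec_smul, monoVec_sub, Finset.smul_sum]
      refine Finset.sum_congr rfl fun t ht => ?_
      rw [monoVec_smul, Matrix.mulVec_smul, smul_smul]
      congr 1
      have ht : t ≤ s := by simpa [Nat.lt_succ_iff] using ht
      have hε' : (ε : ℂ) ≠ 0 := by exact_mod_cast hε
      rw [Complex.ofReal_inv, inv_pow, ← div_eq_mul_inv, pow_sub₀ _ hε' ht, div_eq_mul_inv]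
  have := congrFun key 0
  simp only [zero_smul, sub_zero] at this
  rw [Finset.sum_range_succ, Finset.sum_eq_zero] at this
  · simpa using this.symm
  · intro t ht
    have : s - t ≠ 0 := by
      have := Finset.mem_range.1 ht
      omega
    simp [this]

theorem crystalMat_self_of_linear_eq {d : ℕ} (s : ℕ) (γ : Aff d)
    (h : γ.linear = LinearEquiv.refl ℝ _) : crystalMat s s γ = 1 := by
  rw [crystalMat, shiftMat_self, one_mul, linPart, powMat_inv, h, ← powMat_id]
  rfl

theorem monoVec_zero {d : ℕ} (x : Euc d) : monoVec 0 x = 1 := by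
  funext α
  have : α.1 = 0 := (Finsupp.degree_eq_zero_iff _).1 α.2
  simp [monoVec, this]

theorem monoVec_apply_zero {d s : ℕ} (hs : s ≠ 0) : monoVec s (0 : Euc d) = 0 := by
  have := monoVec_smul s 0 (0 : Euc d)
  simpa [hs] using this

theorem crystalMat_zero_zero {d : ℕ} (γ : Aff d) : crystalMat 0 0 γ = 1 := by
  refine matrix_eq_of_monoVec' _ _ fun x => ?_
  have := monoVec_inv_apply (p := 1) zero_lt_one γ x
  rw [monoVec_zero, Finset.sum_range_one] at this
  rw [← this, Matrix.one_mulVec, monoVec_zero]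

theorem yMat_zero {d r : ℕ} (v : (Fin d →₀ ℕ) → Fin r → ℂ) (γ : Aff d) (α : MultiIdx d 0) :
    yMat v 0 γ α = v 0 := by
  have : α.1 = 0 := (Finsupp.degree_eq_zero_iff _).1 α.2
  funext i
  rw [yMat_eq_sum (p := 1) zero_lt_one, Finset.sum_range_one, crystalMat_zero_zero, Matrix.one_mul]
  simp [this]

/-- For `s ≠ 0` the matrix `A_[s]` of a map with contracting inverse does not have the
eigenvalue `1`. -/
theorem eq_zero_of_powMat_mulVec_eq {d s : ℕ} (hs : s ≠ 0) (A : Euc d ≃ₗ[ℝ] Euc d)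
    (hA : ∀ x : Euc d, Filter.Tendsto (fun n : ℕ => (A.symm ^ n : Euc d ≃ₗ[ℝ] Euc d) x)
      Filter.atTop (nhds 0)) (u : MultiIdx d s → ℂ)
    (hu : powMat A.toLinearMap s *ᵥ u = u) : u = 0 := by
  by_contra hne
  -- Passing to a left eigenvector `w` turns the eigenvalue `1` into an `A`-invariant homogeneous
  -- polynomial `w · X_[s]`.
  obtain ⟨w, hw, hw'⟩ : ∃ w : MultiIdx d s → ℂ, w ≠ 0 ∧
      w ᵥ* (powMat A.toLinearMap s - 1) = 0 := by
    classical
    rw [Matrix.exists_vecMul_eq_zero_iff, ← Matrix.exists_mulVec_eq_zero_iff]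
    exact ⟨u, hne, by rw [Matrix.sub_mulVec, hu, Matrix.one_mulVec, sub_self]⟩
  rw [Matrix.vecMul_sub, Matrix.vecMul_one, sub_eq_zero] at hw'
  have h1 : ∀ x : Euc d, w ⬝ᵥ monoVec s (A x) = w ⬝ᵥ monoVec s x := fun x => by
    have := monoVec_map A.toLinearMap s x
    rw [LinearEquiv.coe_coe] at this
    rw [this, Matrix.dotProduct_mulVec, hw']
  have h2 : ∀ (n : ℕ) (x : Euc d),
      w ⬝ᵥ monoVec s ((A.symm ^ n : Euc d ≃ₗ[ℝ] Euc d) x) = w ⬝ᵥ monoVec s x := by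
    intro n
    induction n with
    | zero => intro x; simp
    | succ n ih =>
      intro x
      rw [pow_succ', LinearEquiv.mul_apply, ← h1, LinearEquiv.apply_symm_apply, ih]
  -- The invariant polynomial can be evaluated along `A⁻ⁿ x → 0`, and it vanishes at the origin
  -- because its degree is positive.
  have h3 : ∀ x : Euc d, w ⬝ᵥ monoVec s x = 0 := by
    intro x
    have hc : Continuous fun y : Euc d => w ⬝ᵥ monoVec s y :=
      continuous_const.dotProduct (continuous_monoVec s)
    have := (hc.tendsto 0).comp (hA x)
    simp only [Function.comp_def, h2, monoVec_apply_zero hs, dotProduct_zero] at this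
    exact tendsto_nhds_unique tendsto_const_nhds this
  have h4 := matrix_eq_of_monoVec' (Matrix.of fun _ : Unit => w) 0 (fun x => by
    funext i; simpa [Matrix.mulVec] using h3 x)
  exact hw (congrFun h4 ())

/-! ### Geometry of crystal groups -/

noncomputable instance instMulActionSubgroup {d : ℕ} (Γ : Subgroup (Aff d)) : MulAction Γ (Euc d) where
  smul γ x := γ.1 x
  one_smul _ := rfl
  mul_smul _ _ _ := rfl

theorem subgroup_smul_def {d : ℕ} {Γ : Subgroup (Aff d)} (γ : Γ) (x : Euc d) :
    γ • x = γ.1 x := rfl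

theorem affine_decomp {d : ℕ} (γ : Aff d) (x : Euc d) : γ x = γ.linear x + γ 0 := by
  have h := γ.map_vadd 0 x
  simpa only [vadd_eq_add, add_zero] using h

theorem aff_ext {d : ℕ} {γ γ' : Aff d} (h : ∀ x, γ x = γ' x) : γ = γ' :=
  AffineEquiv.ext h

theorem aff_apply_eq_sum {d : ℕ} (γ : Aff d) (x : Euc d) :
    γ x = γ 0 + ∑ i, x i • (γ (EuclideanSpace.single i 1) - γ 0) := by
  have hx : x = ∑ j, x j • EuclideanSpace.single j (1 : ℝ) := by
    ext k
    simp [Pi.single_apply]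
  rw [affine_decomp]
  conv_lhs => rw [hx]
  rw [map_sum, add_comm]
  congr 1
  refine Finset.sum_congr rfl fun i _ => ?_
  rw [affine_decomp γ (EuclideanSpace.single i 1), map_smul, add_sub_cancel_right]

section

variable {d : ℕ} {Γ : Subgroup (Aff d)}

/-- An affine map is determined by its values at `0` and the basis vectors, which embeds `Γ` in a
second countable space. The image is discrete because it maps continuously and injectively to the
discrete set of functions. -/
theorem countable_of_isDiscrete
    (h : IsDiscrete ((fun γ : Aff d => (γ : Euc d → Euc d)) '' (Γ : Set (Aff d)))) :
    Countable Γ := by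
  set φ : Γ → Euc d × (Fin d → Euc d) :=
    fun γ => (γ.1 0, fun i => γ.1 (EuclideanSpace.single i 1)) with hφ
  set Φ : Euc d × (Fin d → Euc d) → (Euc d → Euc d) :=
    fun z x => z.1 + ∑ i, x i • (z.2 i - z.1) with hΦ
  have hΦφ : ∀ γ : Γ, Φ (φ γ) = (γ.1 : Euc d → Euc d) := fun γ => by
    funext x
    exact (aff_apply_eq_sum γ.1 x).symm
  have hφ_inj : Function.Injective φ := fun γ γ' e => by
    have : Φ (φ γ) = Φ (φ γ') := by rw [e]
    rw [hΦφ, hΦφ] at this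
    exact Subtype.ext (aff_ext fun x => congrFun this x)
  have hΦc : Continuous Φ := by
    refine continuous_pi fun x => ?_
    simp only [hΦ]
    fun_prop
  have hmaps : ∀ z : Set.range φ,
      Φ z.1 ∈ (fun γ : Aff d => (γ : Euc d → Euc d)) '' (Γ : Set (Aff d)) := by
    rintro ⟨_, γ, rfl⟩
    exact ⟨γ.1, γ.2, (hΦφ γ).symm⟩
  have := h.to_subtype
  let Ψ : Set.range φ → ((fun γ : Aff d => (γ : Euc d → Euc d)) '' (Γ : Set (Aff d))) :=
    fun z => ⟨Φ z.1, hmaps z⟩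
  have hΨc : Continuous Ψ := (hΦc.comp continuous_subtype_val).subtype_mk _
  have hΨi : Function.Injective Ψ := by
    rintro ⟨_, γ, rfl⟩ ⟨_, γ', rfl⟩ e
    have e : Φ (φ γ) = Φ (φ γ') := congrArg Subtype.val e
    rw [hΦφ, hΦφ] at e
    exact Subtype.ext (congrArg φ (Subtype.ext (aff_ext fun x => congrFun e x)))
  have : DiscreteTopology (Set.range φ) := DiscreteTopology.of_continuous_injective hΨc hΨi
  have : Countable (Set.range φ) := countable_of_Lindelof_of_discrete
  exact (Set.rangeFactorization_injective.2 hφ_inj).countable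

theorem norm_linear_of_isometry {γ : Aff d} (h : Isometry γ) (v : Euc d) :
    ‖γ.linear v‖ = ‖v‖ := by
  have := h.dist_eq v 0
  rwa [affine_decomp γ v, dist_eq_norm, add_sub_cancel_right, dist_zero_right] at this

theorem measurePreserving_of_isometry {γ : Aff d} (h : Isometry γ) :
    MeasurePreserving γ (volume : Measure (Euc d)) volume := by
  let e : Euc d ≃ₗᵢ[ℝ] Euc d := ⟨γ.linear, norm_linear_of_isometry h⟩
  have h1 : MeasurePreserving e (volume : Measure (Euc d)) volume := e.measurePreserving
  have h2 := (measurePreserving_add_right (volume : Measure (Euc d)) (γ 0)).comp h1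
  convert h2 using 1
  funext x
  exact affine_decomp γ x

theorem IsCrystalGroup.measurePreserving (hΓ : IsCrystalGroup Γ) (γ : Γ) :
    MeasurePreserving γ.1 (volume : Measure (Euc d)) volume :=
  measurePreserving_of_isometry (hΓ.isometry γ.1 γ.2)

theorem IsCrystalGroup.countable (hΓ : IsCrystalGroup Γ) : Countable Γ :=
  countable_of_isDiscrete hΓ.discrete

theorem IsCrystalGroup.volume_image (hΓ : IsCrystalGroup Γ) (γ : Γ) (s : Set (Euc d)) :
    volume (γ.1 '' s) = volume s := by
  have h1 : γ.1 '' s = (γ⁻¹ : Γ).1 ⁻¹' s := by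
    ext x
    constructor
    · rintro ⟨y, hy, rfl⟩
      simpa [AffineEquiv.inv_def] using hy
    · intro hx
      exact ⟨_, hx, by simp [AffineEquiv.inv_def]⟩
  rw [h1]
  refine (hΓ.measurePreserving γ⁻¹).measure_preimage_emb ?_ s
  exact (hΓ.isometry _ (γ⁻¹).2).isClosedEmbedding.measurableEmbedding

theorem IsCrystalGroup.isOpenMap (hΓ : IsCrystalGroup Γ) (γ : Γ) : IsOpenMap γ.1 := by
  have hc : Continuous (γ⁻¹ : Γ).1 := (hΓ.isometry _ (γ⁻¹).2).continuous
  intro s hs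
  have h1 : γ.1 '' s = (γ⁻¹ : Γ).1 ⁻¹' s := by
    ext x
    constructor
    · rintro ⟨y, hy, rfl⟩
      simpa [AffineEquiv.inv_def] using hy
    · intro hx
      exact ⟨_, hx, by simp [AffineEquiv.inv_def]⟩
  rw [h1]
  exact hs.preimage hc

theorem IsFundDomain.volume_pos (hΓ : IsCrystalGroup Γ) {P : Set (Euc d)}
    (hP : IsFundDomain Γ P) : 0 < volume P := by
  have := hΓ.countable
  rw [pos_iff_ne_zero]
  intro h0
  have h1 : (Set.univ : Set (Euc d)) = ⋃ γ : Γ, γ.1 '' P := by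
    symm
    rw [Set.eq_univ_iff_forall]
    intro x
    obtain ⟨γ, hγ, hx⟩ := hP.covers x
    exact Set.mem_iUnion.2 ⟨⟨γ, hγ⟩, hx⟩
  have h2 : volume (Set.univ : Set (Euc d)) = 0 := by
    rw [h1, measure_iUnion_null_iff]
    intro γ
    rw [hΓ.volume_image, h0]
  exact (isOpen_univ.measure_ne_zero volume Set.univ_nonempty) h2

theorem IsFundDomain.volume_interior {P : Set (Euc d)} (hP : IsFundDomain Γ P) :
    volume (interior P) = volume P := by
  refine le_antisymm (measure_mono interior_subset) ?_
  have h : P ⊆ interior P ∪ frontier P := by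
    rw [← closure_eq_interior_union_frontier]
    exact subset_closure
  refine (measure_mono h).trans ((measure_union_le _ _).trans ?_)
  rw [hP.frontier_null, add_zero]

/-- Volume packing: the copies `γ(P°)` are disjoint, have the same positive volume, and lie in a
fixed ball. -/
theorem IsCrystalGroup.finite_norm_le (hΓ : IsCrystalGroup Γ) (R : ℝ) :
    {γ : Γ | ‖γ.1 0‖ ≤ R}.Finite := by
  obtain ⟨P, hP⟩ := hΓ.exists_fundDomain
  obtain ⟨D, hD⟩ := hP.isCompact.isBounded.exists_norm_le
  let As : {γ : Γ | ‖γ.1 0‖ ≤ R} → Set (Euc d) := fun γ => γ.1.1 '' interior P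
  have hfin := Measure.finite_const_le_meas_of_disjoint_iUnion (volume : Measure (Euc d))
    (hP.volume_pos hΓ) (As := As)
    (fun γ => (hΓ.isOpenMap γ.1 _ isOpen_interior).measurableSet)
    (fun γ γ' hne => by
      rw [Function.onFun, Set.disjoint_iff_inter_eq_empty]
      by_contra h
      exact hne (Subtype.ext (Subtype.ext
        (hP.tiles _ γ.1.2 _ γ'.1.2 (Set.nonempty_iff_ne_empty.2 h)))))
    (by
      refine ne_of_lt (lt_of_le_of_lt (measure_mono (Set.iUnion_subset fun γ => ?_))
        (measure_closedBall_lt_top (x := (0 : Euc d)) (r := R + D)))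
      rintro _ ⟨y, hy, rfl⟩
      rw [mem_closedBall_zero_iff, affine_decomp, add_comm]
      refine (norm_add_le _ _).trans (add_le_add γ.2 ?_)
      rw [norm_linear_of_isometry (hΓ.isometry _ γ.1.2)]
      exact hD y (interior_subset hy))
  have huniv : {γ | volume P ≤ volume (As γ)} = Set.univ := by
    refine Set.eq_univ_of_forall fun γ => ?_
    change volume P ≤ volume (γ.1.1 '' interior P)
    rw [hΓ.volume_image, hP.volume_interior]
  rw [huniv] at hfin
  exact Set.finite_coe_iff.1 (Set.finite_univ_iff.1 hfin)

open scoped Pointwise in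
theorem IsFundDomain.isFundamentalDomain (hΓ : IsCrystalGroup Γ) {P : Set (Euc d)}
    (hP : IsFundDomain Γ P) : IsFundamentalDomain Γ P (volume : Measure (Euc d)) where
  nullMeasurableSet := hP.isCompact.measurableSet.nullMeasurableSet
  ae_covers := Filter.Eventually.of_forall fun x => by
    obtain ⟨γ, hγ, y, hy, rfl⟩ := hP.covers x
    refine ⟨⟨γ, hγ⟩⁻¹, ?_⟩
    rw [subgroup_smul_def]
    simpa [AffineEquiv.inv_def] using hy
  aedisjoint := by
    intro γ γ' hne
    -- A point common to two tiles and interior to both would identify the two group elements, so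
    -- overlaps lie in images of the null set `∂P`.
    have hsub : (γ • P) ∩ (γ' • P) ⊆ γ.1 '' frontier P ∪ γ'.1 '' frontier P := by
      rintro x ⟨⟨y, hy, rfl⟩, ⟨y', hy', e⟩⟩
      by_contra hx
      rw [Set.mem_union, not_or] at hx
      have hint : ∀ z ∈ P, z ∉ frontier P → z ∈ interior P := fun z hz hzf => by
        by_contra h
        exact hzf ⟨subset_closure hz, h⟩
      refine hne (Subtype.ext (hP.tiles _ γ.2 _ γ'.2 ⟨γ.1 y, ⟨y, hint y hy ?_, rfl⟩,
        ⟨y', hint y' hy' ?_, e⟩⟩))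
      · exact fun h => hx.1 ⟨y, h, rfl⟩
      · exact fun h => hx.2 ⟨y', h, e⟩
    refine measure_mono_null hsub (measure_union_null ?_ ?_) <;>
    rw [hΓ.volume_image, hP.frontier_null]

theorem IsCrystalGroup.smulInvariantMeasure (hΓ : IsCrystalGroup Γ) :
    SMulInvariantMeasure Γ (Euc d) volume where
  measure_preimage_smul γ _ hs := (hΓ.measurePreserving γ).measure_preimage hs.nullMeasurableSet

theorem IsCrystalGroup.measurableConstSMul (hΓ : IsCrystalGroup Γ) :
    MeasurableConstSMul Γ (Euc d) where
  measurable_const_smul γ := (hΓ.measurePreserving γ).measurable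

/-- Unfolding of an integral over `ℝ^d` along a fundamental domain. -/
theorem IsFundDomain.integral_eq_tsum (hΓ : IsCrystalGroup Γ) {P : Set (Euc d)}
    (hP : IsFundDomain Γ P) {g : Euc d → ℂ} (hg : Integrable g) :
    ∫ x, g x = ∑' γ : Γ, ∫ x in P, g (γ.1 x) := by
  have := hΓ.countable
  have := hΓ.smulInvariantMeasure
  have := hΓ.measurableConstSMul
  exact (hP.isFundamentalDomain hΓ).integral_eq_tsum'' g hg

/-- In a splitting crystal group the translation by `γ 0` belongs to the group. -/
theorem IsSplittingCrystalGroup.translation_mem (hΓ : IsSplittingCrystalGroup Γ) (γ : Γ) :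
    ∃ τ : Γ, τ.1.linear = LinearEquiv.refl ℝ _ ∧ ∀ x, τ.1 x = x + γ.1 0 := by
  -- Precomposing `γ` with the inverse of its linear part leaves a pure translation; splitting keeps
  -- it in `Γ`.
  have hx : ∀ x, (γ.1 * (γ.1.linear.toAffineEquiv)⁻¹) x = x + γ.1 0 := fun x => by
    rw [AffineEquiv.coe_mul, Function.comp_apply, affine_decomp]
    congr 1
    exact γ.1.linear.apply_symm_apply x
  refine ⟨⟨γ.1 * (γ.1.linear.toAffineEquiv)⁻¹,
    Γ.mul_mem γ.2 (Γ.inv_mem (hΓ.splits γ.1 γ.2))⟩, ?_, hx⟩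
  ext x : 1
  have h1 := affine_decomp (γ.1 * (γ.1.linear.toAffineEquiv)⁻¹) x
  rw [hx x, hx 0, zero_add] at h1
  exact (add_right_cancel h1).symm

/-- If `x = γ y` with `y ∈ P`, then `‖γ 0 - x‖ = ‖y‖`, which is bounded on `P`. -/
theorem IsCrystalGroup.exists_near (hΓ : IsCrystalGroup Γ) :
    ∃ R : ℝ, ∀ x : Euc d, ∃ γ : Γ, ‖γ.1 0 - x‖ ≤ R := by
  obtain ⟨P, hP⟩ := hΓ.exists_fundDomain
  obtain ⟨D, hD⟩ := hP.isCompact.isBounded.exists_norm_le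
  refine ⟨D, fun x => ?_⟩
  obtain ⟨γ, hγ, y, hy, rfl⟩ := hP.covers x
  refine ⟨⟨γ, hγ⟩, ?_⟩
  rw [← dist_eq_norm, (hΓ.isometry γ hγ).dist_eq, dist_zero_left]
  exact hD y hy

end

/-! ### Contraction by the inverse of an expansive map -/

section Gelfand

attribute [local instance] Matrix.linftyOpNormedRing Matrix.linftyOpNormedAlgebra

/-- Gelfand's formula: for `ρ` strictly between the spectral radius and `1`, eventually `‖N ^ m‖ ≤ ρ
^ m`. -/
theorem matrix_pow_tendsto_zero {n : Type*} [Fintype n] [DecidableEq n] (N : Matrix n n ℂ)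
    (hN : ∀ k ∈ spectrum ℂ N, ‖k‖ < 1) :
    Filter.Tendsto (fun m : ℕ => N ^ m) Filter.atTop (nhds 0) := by
  have hr : spectralRadius ℂ N < 1 := by
    rcases isEmpty_or_nonempty n with h | h
    · have : Subsingleton (Matrix n n ℂ) := inferInstance
      rw [spectralRadius]
      simp
    · have := spectrum.spectralRadius_lt_of_forall_lt N (r := 1)
        (fun k hk => by simpa [← NNReal.coe_lt_coe] using hN k hk)
      simpa using this
  obtain ⟨ρ, hρ1, hρ2⟩ := ENNReal.lt_iff_exists_nnreal_btwn.1 hr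
  have hρ2 : ρ < 1 := by exact_mod_cast hρ2
  have h1 := (spectrum.pow_nnnorm_pow_one_div_tendsto_nhds_spectralRadius N).eventually_lt_const hρ1
  refine (tendsto_zero_iff_norm_tendsto_zero (E := Matrix n n ℂ)).2 ?_
  refine squeeze_zero' (Filter.Eventually.of_forall fun m => norm_nonneg _) ?_
    (tendsto_pow_atTop_nhds_zero_of_lt_one ρ.2 (by exact_mod_cast hρ2))
  filter_upwards [h1, Filter.eventually_gt_atTop 0] with m hm hm0
  have hm' : (m : ℝ) ≠ 0 := by positivity
  have h2 := ENNReal.rpow_le_rpow hm.le (Nat.cast_nonneg (α := ℝ) m)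
  rw [← ENNReal.rpow_mul, one_div, inv_mul_cancel₀ hm', ENNReal.rpow_one,
    ENNReal.rpow_natCast] at h2
  have h3 : ‖N ^ m‖₊ ≤ ρ ^ m := by exact_mod_cast h2
  exact_mod_cast h3

end Gelfand

theorem IsExpansive.tendsto_symm_pow {d : ℕ} {A : Euc d ≃ₗ[ℝ] Euc d}
    (hA : IsExpansive A.toLinearMap) (x : Euc d) :
    Filter.Tendsto (fun n : ℕ => (A.symm ^ n : Euc d ≃ₗ[ℝ] Euc d) x) Filter.atTop (nhds 0) := by
  let b : Module.Basis (Fin d) ℝ (Euc d) := (EuclideanSpace.basisFun (Fin d) ℝ).toBasis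
  set M : Matrix (Fin d) (Fin d) ℝ := LinearMap.toMatrix b b A.toLinearMap with hM
  set N : Matrix (Fin d) (Fin d) ℝ := LinearMap.toMatrix b b A.symm.toLinearMap with hN
  have hMN : M * N = 1 := by
    rw [hM, hN, ← LinearMap.toMatrix_comp, ← LinearMap.toMatrix_id b]
    congr 1
    ext y : 1
    simp
  have hNM : N * M = 1 := mul_eq_one_comm.1 hMN
  let ι : ℝ →+* ℂ := algebraMap ℝ ℂ
  let u : (Matrix (Fin d) (Fin d) ℂ)ˣ :=
    ⟨ι.mapMatrix M, ι.mapMatrix N, by rw [← map_mul, hMN, map_one],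
      by rw [← map_mul, hNM, map_one]⟩
  -- The spectrum of the complexified inverse consists of reciprocals of roots of the characteristic
  -- polynomial of `A`.
  have hspec : ∀ k ∈ spectrum ℂ (ι.mapMatrix N), ‖k‖ < 1 := by
    intro k hk
    have hk0 : k ≠ 0 := by
      rintro rfl
      exact spectrum.zero_notMem ℂ (u⁻¹).isUnit hk
    have hk' : k⁻¹ ∈ spectrum ℂ (ι.mapMatrix M) := by
      have := (spectrum.inv_mem_iff (r := Units.mk0 k hk0) (a := u⁻¹)).1 hk
      rw [inv_inv, Units.val_inv_eq_inv_val] at this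
      exact this
    change k⁻¹ ∈ spectrum ℂ (M.map ι) at hk'
    rw [Matrix.mem_spectrum_iff_isRoot_charpoly, Matrix.charpoly_map] at hk'
    have h2 := hA k⁻¹ (by
      rw [← LinearMap.charpoly_toMatrix A.toLinearMap b, Polynomial.aeval_def,
        ← Polynomial.eval_map]
      exact hk')
    rw [norm_inv] at h2
    exact (one_lt_inv₀ (norm_pos_iff.2 hk0)).1 h2
  have h1 := matrix_pow_tendsto_zero _ hspec
  have h2 : Filter.Tendsto (fun n : ℕ => N ^ n) Filter.atTop (nhds 0) := by
    refine tendsto_pi_nhds.2 fun i => tendsto_pi_nhds.2 fun j => ?_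
    have h3 := (tendsto_pi_nhds.1 (tendsto_pi_nhds.1 h1 i) j)
    have h4 := (Complex.continuous_re.tendsto _).comp h3
    refine h4.congr fun n => ?_
    change ((ι.mapMatrix N ^ n) i j).re = _
    rw [← map_pow ι.mapMatrix N n]
    rfl
  have h5 : ∀ n : ℕ, (A.symm ^ n : Euc d ≃ₗ[ℝ] Euc d) x =
      WithLp.toLp 2 (N ^ n *ᵥ (x : Fin d → ℝ)) := by
    intro n
    have h6 : N ^ n = LinearMap.toMatrix b b (A.symm.toLinearMap ^ n) := by
      rw [hN, LinearMap.toMatrix_pow]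
    have h7 : (A.symm ^ n : Euc d ≃ₗ[ℝ] Euc d) x = (A.symm.toLinearMap ^ n) x := by
      induction n with
      | zero => simp
      | succ n ih =>
        rw [pow_succ', pow_succ', LinearEquiv.mul_apply, ih (by
          rw [hN, LinearMap.toMatrix_pow])]
        rfl
    rw [h7, h6]
    have h8 := LinearMap.toMatrix_mulVec_repr b b (A.symm.toLinearMap ^ n) x
    ext i
    exact (congrFun h8 i).symm
  simp_rw [h5]
  have hc : Continuous fun Q : Matrix (Fin d) (Fin d) ℝ =>
      (WithLp.toLp 2 (Q *ᵥ (x : Fin d → ℝ)) : Euc d) := by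
    refine (PiLp.continuous_toLp 2 _).comp ?_
    fun_prop
  have := (hc.tendsto 0).comp h2
  simpa [Function.comp_def] using this

/-- The convergence is uniform on balls, since by linearity it is controlled by finitely many basis
vectors; the argument may therefore vary with `n`. -/
theorem tendsto_symm_pow_of_norm_le {d : ℕ} {A : Euc d ≃ₗ[ℝ] Euc d}
    (hA : IsExpansive A.toLinearMap) (y : ℕ → Euc d) (R : ℝ) (hy : ∀ n, ‖y n‖ ≤ R) :
    Filter.Tendsto (fun n : ℕ => (A.symm ^ n : Euc d ≃ₗ[ℝ] Euc d) (y n))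
      Filter.atTop (nhds 0) := by
  have h1 : Filter.Tendsto (fun n : ℕ => ∑ i, R *
      ‖(A.symm ^ n : Euc d ≃ₗ[ℝ] Euc d) (EuclideanSpace.single i 1)‖)
      Filter.atTop (nhds 0) := by
    have : (0 : ℝ) = ∑ i : Fin d, R * ‖(0 : Euc d)‖ := by simp
    rw [this]
    exact tendsto_finsetSum _ fun i _ => ((hA.tendsto_symm_pow _).norm).const_mul R
  refine squeeze_zero_norm (fun n => ?_) h1
  have hx : y n = ∑ j, y n j • EuclideanSpace.single j (1 : ℝ) := by
    ext k
    simp [Pi.single_apply]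
  conv_lhs => rw [hx]
  rw [map_sum]
  refine (norm_sum_le _ _).trans (Finset.sum_le_sum fun i _ => ?_)
  rw [map_smul, norm_smul]
  refine mul_le_mul_of_nonneg_right ?_ (norm_nonneg _)
  exact (PiLp.norm_apply_le (y n) i).trans (hy n)

/-! ### Functions with a dense set of periods -/

theorem continuous_setIntegral_closedBall {d : ℕ} {g : Euc d → ℂ}
    (hg : LocallyIntegrable g) {ρ : ℝ} (hρ : 0 < ρ) :
    Continuous fun x : Euc d => ∫ y in Metric.closedBall x ρ, g y := by
  rw [continuous_iff_continuousAt]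
  intro x
  have e : ∀ z : Euc d, ∫ y in Metric.closedBall z ρ, g y =
      ∫ y, (Metric.closedBall z ρ).indicator g y := fun z =>
    (integral_indicator measurableSet_closedBall).symm
  simp_rw [ContinuousAt, e]
  refine tendsto_integral_filter_of_dominated_convergence
    ((Metric.closedBall x (ρ + 1)).indicator fun y => ‖g y‖) ?_ ?_ ?_ ?_
  · exact Filter.Eventually.of_forall fun z =>
      hg.aestronglyMeasurable.indicator measurableSet_closedBall
  · filter_upwards [Metric.ball_mem_nhds x one_pos] with z hz
    refine Filter.Eventually.of_forall fun y => ?_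
    rw [norm_indicator_eq_indicator_norm]
    refine Set.indicator_le_indicator_of_subset (fun w hw => ?_) (fun _ => norm_nonneg _) y
    rw [Metric.mem_closedBall] at hw ⊢
    have := dist_triangle w z x
    have := Metric.mem_ball.1 hz
    linarith
  · rw [integrable_indicator_iff measurableSet_closedBall]
    exact (hg.integrableOn_isCompact (isCompact_closedBall x (ρ + 1))).norm
  -- Off the null sphere about `x`, the indicator at `y` is locally constant in the centre of the
  -- ball.
  · have hs : ∀ᵐ y : Euc d, y ∉ Metric.sphere x ρ :=
      measure_eq_zero_iff_ae_notMem.1 (Measure.addHaar_sphere_of_ne_zero _ x hρ.ne')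
    filter_upwards [hs] with y hy
    rw [Metric.mem_sphere] at hy
    have hcont : Filter.Tendsto (fun z => dist y z) (nhds x) (nhds (dist y x)) :=
      (continuous_const.dist continuous_id).tendsto x
    refine tendsto_const_nhds.congr' ?_
    rcases lt_or_gt_of_ne hy with h | h
    · filter_upwards [hcont.eventually_lt_const h] with z hz
      rw [Set.indicator_of_mem (Metric.mem_closedBall.2 hz.le),
        Set.indicator_of_mem (Metric.mem_closedBall.2 h.le)]
    · filter_upwards [hcont.eventually_const_lt h] with z hz
      rw [Set.indicator_of_notMem (by simpa using h), Set.indicator_of_notMem (by simpa using hz)]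

/-- Integrals over balls of a fixed radius are continuous in the centre and agree on a dense set of
centres, so the averages do not depend on the centre. Lebesgue differentiation recovers `g` from
them. -/
theorem ae_const_of_dense_periods {d : ℕ} {g : Euc d → ℂ} (hg : LocallyIntegrable g)
    {D : Set (Euc d)} (hD : Dense D) (hper : ∀ t ∈ D, ∀ᵐ x : Euc d, g (x + t) = g x) :
    ∃ c : ℂ, ∀ᵐ x : Euc d, g x = c := by
  have h1 : ∀ ρ : ℝ, 0 < ρ → ∀ x : Euc d,
      ∫ y in Metric.closedBall x ρ, g y = ∫ y in Metric.closedBall (0 : Euc d) ρ, g y := by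
    intro ρ hρ
    have hc := continuous_setIntegral_closedBall hg hρ
    refine fun x => congrFun (Continuous.ext_on hD hc continuous_const fun t ht => ?_) x
    have hpre : (fun y => y + t) ⁻¹' Metric.closedBall t ρ = Metric.closedBall (0 : Euc d) ρ := by
      ext y
      simp
    have := (measurePreserving_add_right (volume : Measure (Euc d)) t).setIntegral_preimage_emb
      (measurableEmbedding_addRight t) g (Metric.closedBall t ρ)
    rw [hpre] at this
    rw [← this]
    exact integral_congr_ae (ae_restrict_of_ae (hper t ht))
  have h2 : ∀ ρ : ℝ, 0 < ρ → ∀ x : Euc d,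
      ⨍ y in Metric.closedBall x ρ, g y = ⨍ y in Metric.closedBall (0 : Euc d) ρ, g y := by
    intro ρ hρ x
    rw [setAverage_eq, setAverage_eq, h1 ρ hρ x, measureReal_def, measureReal_def,
      Measure.addHaar_closedBall_center]
  have h3 : ∀ᵐ x : Euc d, Filter.Tendsto (fun ρ => ⨍ y in Metric.closedBall (0 : Euc d) ρ, g y)
      (nhdsWithin 0 (Set.Ioi 0)) (nhds (g x)) := by
    filter_upwards [(Besicovitch.vitaliFamily (volume : Measure (Euc d))).ae_tendsto_average hg]
      with x hx
    refine (hx.comp (Besicovitch.tendsto_filterAt volume x)).congr' ?_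
    filter_upwards [self_mem_nhdsWithin] with ρ hρ
    exact h2 ρ hρ x
  obtain ⟨x₀, hx₀⟩ := h3.exists
  refine ⟨g x₀, ?_⟩
  filter_upwards [h3] with x hx
  exact tendsto_nhds_unique hx hx₀

/-! ### Infinite combinations of translates -/

theorem finsum_eq_sum_of_forall_notMem {ι M : Type*} [AddCommMonoid M] {g : ι → M} {S : Finset ι}
    (h : ∀ i ∉ S, g i = 0) : ∑ᶠ i, g i = ∑ i ∈ S, g i :=
  finsum_eq_sum_of_support_subset _ fun i hi => by
    by_contra hS
    exact hi (h i hS)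

/-- The function `∑_γ b_γ f(γ x)`. -/
noncomputable def translateSum {d r : ℕ} (Γ : Subgroup (Aff d)) (f : Euc d → Fin r → ℂ)
    (b : Γ → Fin r → ℂ) (x : Euc d) : ℂ :=
  ∑ᶠ γ : Γ, b γ ⬝ᵥ f (γ.1 x)

section

variable {d r : ℕ} {Γ : Subgroup (Aff d)} {f : Euc d → Fin r → ℂ}

/-- If `f(γ x) ≠ 0` and `‖x‖ ≤ R`, then `γ 0` lies in a fixed ball. So infinite combinations are
finite sums, with one index set for each bounded region. -/
theorem IsCrystalGroup.exists_finset (hΓ : IsCrystalGroup Γ) (hf : HasCompactSupport f) (R : ℝ) :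
    ∃ S : Finset Γ, ∀ x : Euc d, ‖x‖ ≤ R → ∀ γ ∉ S, f (γ.1 x) = 0 := by
  obtain ⟨D, hD⟩ := hf.isCompact.isBounded.exists_norm_le
  refine ⟨(hΓ.finite_norm_le (D + R)).toFinset, fun x hx γ hγ => ?_⟩
  by_contra h
  refine hγ ?_
  rw [Set.Finite.mem_toFinset, Set.mem_ofPred_eq]
  have h1 := hD _ (subset_tsupport f h)
  have h2 : γ.1 0 = γ.1 x - γ.1.linear x := by rw [affine_decomp γ.1 x, add_sub_cancel_left]
  rw [h2]
  refine (norm_sub_le _ _).trans (add_le_add h1 ?_)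
  rwa [norm_linear_of_isometry (hΓ.isometry _ γ.2)]

theorem translateSum_eq_sum {S : Finset Γ} {x : Euc d} (hS : ∀ γ ∉ S, f (γ.1 x) = 0)
    (b : Γ → Fin r → ℂ) : translateSum Γ f b x = ∑ γ ∈ S, b γ ⬝ᵥ f (γ.1 x) :=
  finsum_eq_sum_of_forall_notMem fun γ hγ => by rw [hS γ hγ, dotProduct_zero]

theorem translateSum_sum (hΓ : IsCrystalGroup Γ) (hf : HasCompactSupport f) {ι : Type*}
    (s : Finset ι) (b : ι → Γ → Fin r → ℂ) (x : Euc d) :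
    translateSum Γ f (fun γ => ∑ i ∈ s, b i γ) x = ∑ i ∈ s, translateSum Γ f (b i) x := by
  obtain ⟨S, hS⟩ := hΓ.exists_finset hf ‖x‖
  simp_rw [translateSum_eq_sum (hS x le_rfl), sum_dotProduct]
  rw [Finset.sum_comm]

theorem translateSum_smul (hΓ : IsCrystalGroup Γ) (hf : HasCompactSupport f) (w : ℂ)
    (b : Γ → Fin r → ℂ) (x : Euc d) :
    translateSum Γ f (fun γ => w • b γ) x = w * translateSum Γ f b x := by
  obtain ⟨S, hS⟩ := hΓ.exists_finset hf ‖x‖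
  simp_rw [translateSum_eq_sum (hS x le_rfl), smul_dotProduct, Finset.mul_sum, smul_eq_mul]

theorem translateSum_sub (hΓ : IsCrystalGroup Γ) (hf : HasCompactSupport f)
    (b b' : Γ → Fin r → ℂ) (x : Euc d) :
    translateSum Γ f (fun γ => b γ - b' γ) x = translateSum Γ f b x - translateSum Γ f b' x := by
  obtain ⟨S, hS⟩ := hΓ.exists_finset hf ‖x‖
  simp_rw [translateSum_eq_sum (hS x le_rfl), sub_dotProduct, Finset.sum_sub_distrib]

theorem translateSum_matrix_row (hΓ : IsCrystalGroup Γ) (hf : HasCompactSupport f) {m : Type*}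
    [Fintype m] (w : m → ℂ) (Y : Γ → Matrix m (Fin r) ℂ) (x : Euc d) :
    translateSum Γ f (fun γ => w ᵥ* Y γ) x =
      w ⬝ᵥ fun β => translateSum Γ f (fun γ => Y γ β) x := by
  have h : (fun γ => w ᵥ* Y γ) = fun γ => ∑ β, w β • Y γ β := by
    funext γ
    exact Matrix.vecMul_eq_sum _ _
  rw [h, translateSum_sum hΓ hf]
  simp_rw [translateSum_smul hΓ hf]
  rfl

theorem finsum_mulVec_apply (hΓ : IsCrystalGroup Γ) (hf : HasCompactSupport f) {m : Type*}
    (Y : Γ → Matrix m (Fin r) ℂ) (x : Euc d) (α : m) :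
    (∑ᶠ γ : Γ, Y γ *ᵥ f (γ.1 x)) α = translateSum Γ f (fun γ => Y γ α) x := by
  obtain ⟨S, hS⟩ := hΓ.exists_finset hf ‖x‖
  rw [translateSum_eq_sum (hS x le_rfl), finsum_eq_sum_of_forall_notMem (S := S),
    Finset.sum_apply]
  · rfl
  · intro γ hγ
    rw [hS x le_rfl γ hγ, Matrix.mulVec_zero]

theorem translateSum_inv_apply (b : Γ → Fin r → ℂ) (σ : Γ) (x : Euc d) :
    translateSum Γ f b (σ.1⁻¹ x) = translateSum Γ f (fun γ => b (γ * σ)) x := by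
  rw [translateSum, translateSum, ← finsum_comp_equiv (Equiv.mulRight σ)]
  refine finsum_congr fun γ => ?_
  rw [Equiv.coe_mulRight, Subgroup.coe_mul, AffineEquiv.coe_mul, Function.comp_apply]
  congr 3
  exact σ.1.apply_symm_apply x

theorem IsCrystalGroup.integrable_apply (hΓ : IsCrystalGroup Γ) (hf : Integrable f) (γ : Γ)
    (i : Fin r) : Integrable fun x => f (γ.1 x) i :=
  Integrable.eval ((hΓ.measurePreserving γ).integrable_comp_of_integrable hf) i

theorem IsCrystalGroup.integrable_dotProduct (hΓ : IsCrystalGroup Γ) (hf : Integrable f) (γ : Γ)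
    (w : Fin r → ℂ) : Integrable fun x => w ⬝ᵥ f (γ.1 x) :=
  integrable_finsetSum _ fun i _ => (hΓ.integrable_apply hf γ i).const_mul (w i)

theorem locallyIntegrable_translateSum (hΓ : IsCrystalGroup Γ) (hf_int : Integrable f)
    (hf : HasCompactSupport f) (b : Γ → Fin r → ℂ) : LocallyIntegrable (translateSum Γ f b) := by
  intro x
  obtain ⟨S, hS⟩ := hΓ.exists_finset hf (‖x‖ + 1)
  refine ⟨Metric.ball x 1, Metric.ball_mem_nhds x one_pos, ?_⟩
  have h : IntegrableOn (fun y => ∑ γ ∈ S, b γ ⬝ᵥ f (γ.1 y)) (Metric.ball x 1) :=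
    (integrable_finsetSum S fun γ _ => hΓ.integrable_dotProduct hf_int γ (b γ)).integrableOn
  refine h.congr_fun (fun y hy => ?_) measurableSet_ball
  refine (translateSum_eq_sum (hS y ?_) b).symm
  have h1 := mem_ball_iff_norm.1 hy
  have h2 := norm_sub_norm_le y x
  linarith

/-- The infinite row vector `b L`. -/
noncomputable def rowMulRefMat (Γ : Subgroup (Aff d)) (A : Euc d ≃ₗ[ℝ] Euc d)
    (c : Aff d →₀ Matrix (Fin r) (Fin r) ℂ) (b : Γ → Fin r → ℂ) (σ : Γ) : Fin r → ℂ :=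
  ∑ᶠ γ : Γ, b γ ᵥ* refMat A c γ.1 σ.1

/-- The columns of `L` are finite, so `b L` makes sense for arbitrary `b`. -/
theorem finite_refMat_ne_zero (A : Euc d ≃ₗ[ℝ] Euc d)
    (c : Aff d →₀ Matrix (Fin r) (Fin r) ℂ) (σ : Γ) :
    {γ : Γ | refMat A c γ.1 σ.1 ≠ 0}.Finite := by
  refine Set.Finite.of_finite_image (f := fun γ : Γ =>
    A.toAffineEquiv * γ.1 * A.toAffineEquiv⁻¹ * σ.1⁻¹) (c.support.finite_toSet.subset ?_) ?_
  · rintro _ ⟨γ, hγ, rfl⟩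
    exact Finsupp.mem_support_iff.2 hγ
  · intro γ _ γ' _ h
    simpa using h

theorem finsum_mul_refMat_apply (A : Euc d ≃ₗ[ℝ] Euc d)
    (c : Aff d →₀ Matrix (Fin r) (Fin r) ℂ) {m : Type*} (Y : Γ → Matrix m (Fin r) ℂ)
    (σ : Γ) (α : m) :
    (∑ᶠ γ : Γ, Y γ * refMat A c γ.1 σ.1) α = rowMulRefMat Γ A c (fun γ => Y γ α) σ := by
  set S := (finite_refMat_ne_zero (Γ := Γ) A c σ).toFinset with hS
  have h : ∀ γ ∉ S, refMat A c γ.1 σ.1 = 0 := fun γ hγ => by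
    simpa [hS] using hγ
  rw [rowMulRefMat, finsum_eq_sum_of_forall_notMem (S := S),
    finsum_eq_sum_of_forall_notMem (S := S)]
  · refine (Finset.sum_apply α S _).trans (Finset.sum_congr rfl fun γ _ => ?_)
    exact Matrix.mul_apply_eq_vecMul _ _ _
  · intro γ hγ
    rw [h γ hγ, Matrix.vecMul_zero]
  · intro γ hγ
    rw [h γ hγ, Matrix.mul_zero]

theorem quasiMeasurePreserving_linearEquiv (A : Euc d ≃ₗ[ℝ] Euc d) :
    Measure.QuasiMeasurePreserving A (volume : Measure (Euc d)) volume :=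
  Measure.LinearMap.quasiMeasurePreserving volume A.toLinearMap A.isUnit_det'.ne_zero

/-- The refinement equation for all translates at once: `F(x) = L F(A x)`. -/
theorem IsRefinable.apply_eq (hΓ : IsCrystalGroup Γ) {A : Euc d ≃ₗ[ℝ] Euc d}
    (hA : IsAdmissible Γ A) {c : Aff d →₀ Matrix (Fin r) (Fin r) ℂ}
    (href : IsRefinable Γ A c f) :
    ∀ᵐ x : Euc d, ∀ S : Finset Γ, (∀ σ ∉ S, f (σ.1 (A x)) = 0) → ∀ γ : Γ,
      f (γ.1 x) = ∑ σ ∈ S, refMat A c γ.1 σ.1 *ᵥ f (σ.1 (A x)) := by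
  classical
  have := hΓ.countable
  have h : ∀ᵐ x : Euc d, ∀ γ : Γ, f (γ.1 x) =
      ∑ τ ∈ c.support, c τ *ᵥ f (τ⁻¹ (A (γ.1 x))) := by
    rw [ae_all_iff]
    exact fun γ => (hΓ.measurePreserving γ).quasiMeasurePreserving.ae href.refinement
  filter_upwards [h] with x hx S hS γ
  rw [hx γ]
  set δ : Aff d := A.toAffineEquiv * γ.1 * A.toAffineEquiv⁻¹ with hδ
  have hδx : ∀ τ : Aff d, τ⁻¹ (A (γ.1 x)) = (τ⁻¹ * δ) (A x) := fun τ => by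
    change _ = τ⁻¹ (A (γ.1 (A.symm (A x))))
    rw [A.symm_apply_apply]
  have hmem : ∀ τ ∈ c.support, τ⁻¹ * δ ∈ Γ := fun τ hτ =>
    Γ.mul_mem (Γ.inv_mem (href.support_subset τ hτ)) (hA.conj_mem γ.1 γ.2)
  -- Substitute `σ = τ⁻¹ A γ A⁻¹`, which is in `Γ` by admissibility. Only nonzero terms are matched,
  -- since the two index sets need not correspond exactly.
  refine Finset.sum_bij_ne_zero (fun τ hτ _ => ⟨τ⁻¹ * δ, hmem τ hτ⟩) ?_ ?_ ?_ ?_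
  · intro τ hτ hne
    by_contra h'
    refine hne ?_
    rw [hδx, hS _ h', Matrix.mulVec_zero]
  · intro τ _ _ τ' _ _ e
    simpa using congrArg Subtype.val e
  · intro σ hσ hne
    have e : (δ * σ.1⁻¹)⁻¹ * δ = σ.1 := by group
    refine ⟨δ * σ.1⁻¹, ?_, ?_, Subtype.ext e⟩
    · rw [Finsupp.mem_support_iff]
      intro h0
      refine hne ?_
      rw [refMat, h0, Matrix.zero_mulVec]
    · rw [hδx, e]
      exact hne
  · intro τ hτ _
    rw [hδx, refMat]
    congr 2
    simp [← hδ]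

/-- This is the associativity `b (L F) = (b L) F`. The exceptional null set is independent of `b`.
-/
theorem translateSum_refine (hΓ : IsCrystalGroup Γ) {A : Euc d ≃ₗ[ℝ] Euc d}
    (hA : IsAdmissible Γ A) {c : Aff d →₀ Matrix (Fin r) (Fin r) ℂ} (hf : HasCompactSupport f)
    (href : IsRefinable Γ A c f) :
    ∀ᵐ x : Euc d, ∀ b : Γ → Fin r → ℂ,
      translateSum Γ f b x = translateSum Γ f (rowMulRefMat Γ A c b) (A x) := by
  classical
  filter_upwards [href.apply_eq hΓ hA] with x hx b
  obtain ⟨S, hS⟩ := hΓ.exists_finset hf ‖A x‖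
  have hS := hS (A x) le_rfl
  obtain ⟨S₀, hS₀⟩ := hΓ.exists_finset hf ‖x‖
  have hS₀ := hS₀ x le_rfl
  -- `S'` must catch both the translates that are nonzero at `x` and the supports of the columns of
  -- `L` indexed by `S`.
  set S' : Finset Γ := S₀ ∪ S.biUnion fun σ => (finite_refMat_ne_zero (Γ := Γ) A c σ).toFinset
    with hS'
  rw [translateSum_eq_sum (S := S') (fun γ hγ => hS₀ γ fun h => hγ (Finset.mem_union_left _ h)),
    translateSum_eq_sum hS]
  have h1 : ∀ γ : Γ, b γ ⬝ᵥ f (γ.1 x) =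
      ∑ σ ∈ S, (b γ ᵥ* refMat A c γ.1 σ.1) ⬝ᵥ f (σ.1 (A x)) := fun γ => by
    rw [hx S hS γ, dotProduct_sum]
    exact Finset.sum_congr rfl fun σ _ => Matrix.dotProduct_mulVec _ _ _
  rw [Finset.sum_congr rfl fun γ _ => h1 γ, Finset.sum_comm]
  refine Finset.sum_congr rfl fun σ hσ => ?_
  rw [← sum_dotProduct, rowMulRefMat, finsum_eq_sum_of_forall_notMem (S := S')]
  intro γ hγ
  have h0 : refMat A c γ.1 σ.1 = 0 := by
    by_contra h0
    refine hγ (Finset.mem_union_right _ (Finset.mem_biUnion.2 ⟨σ, hσ, ?_⟩))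
    simpa using h0
  rw [h0, Matrix.vecMul_zero]

/-! ### Integrals of translates over a fundamental domain -/

theorem fourier_zero_eq_integral (f : Euc d → Fin r → ℂ) : 𝓕 f 0 = ∫ x, f x := by
  simp [Real.fourier_eq]

theorem dotProduct_fourier_zero (hf : Integrable f) (w : Fin r → ℂ) :
    w ⬝ᵥ 𝓕 f 0 = ∫ x, w ⬝ᵥ f x := by
  rw [fourier_zero_eq_integral]
  simp only [dotProduct]
  rw [integral_finsetSum _ fun i _ => (Integrable.eval hf i).const_mul (w i)]
  refine Finset.sum_congr rfl fun i _ => ?_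
  rw [integral_const_mul, eval_integral fun i => Integrable.eval hf i]

theorem setIntegral_translateSum_const (hΓ : IsCrystalGroup Γ) (hf_int : Integrable f)
    (hf : HasCompactSupport f) {P : Set (Euc d)} (hP : IsFundDomain Γ P) (w : Fin r → ℂ) :
    ∫ x in P, translateSum Γ f (fun _ => w) x = w ⬝ᵥ 𝓕 f 0 := by
  obtain ⟨R, hR⟩ := hP.isCompact.isBounded.exists_norm_le
  obtain ⟨S, hS⟩ := hΓ.exists_finset hf R
  rw [dotProduct_fourier_zero hf_int, hP.integral_eq_tsum hΓ (g := fun x => w ⬝ᵥ f x)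
    (integrable_finsetSum _ fun i _ => (Integrable.eval hf_int i).const_mul (w i)),
    tsum_eq_sum (s := S), ← integral_finsetSum]
  · exact setIntegral_congr_fun hP.isCompact.measurableSet fun x hx =>
      translateSum_eq_sum (hS x (hR x hx)) _
  · exact fun γ _ => (hΓ.integrable_dotProduct hf_int γ w).integrableOn
  · intro γ hγ
    rw [setIntegral_congr_fun (g := fun _ => 0) hP.isCompact.measurableSet, integral_zero]
    intro x hx
    dsimp only
    rw [hS x (hR x hx) γ hγ, dotProduct_zero]

end

/-! ### Equivariant functions are constant -/

section

variable {d r : ℕ} {Γ : Subgroup (Aff d)} {f : Euc d → Fin r → ℂ}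

/-- Some `γ_n 0` lies within a fixed distance of `Aⁿ x`, and `A⁻ⁿ` shrinks this error to zero. -/
theorem dense_symm_pow_orbit (hΓ : IsCrystalGroup Γ) {A : Euc d ≃ₗ[ℝ] Euc d}
    (hA : IsExpansive A.toLinearMap) :
    Dense {t : Euc d | ∃ (n : ℕ) (γ : Γ), t = (A.symm ^ n : Euc d ≃ₗ[ℝ] Euc d) (γ.1 0)} := by
  obtain ⟨R, hR⟩ := hΓ.exists_near
  intro x
  choose γ hγ using fun n : ℕ => hR ((A ^ n : Euc d ≃ₗ[ℝ] Euc d) x)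
  have h1 := tendsto_symm_pow_of_norm_le hA _ R hγ
  have h2 : ∀ n : ℕ, (A.symm ^ n : Euc d ≃ₗ[ℝ] Euc d) ((A ^ n : Euc d ≃ₗ[ℝ] Euc d) x) = x := by
    intro n
    change (A⁻¹ ^ n * A ^ n : Euc d ≃ₗ[ℝ] Euc d) x = x
    rw [inv_pow, inv_mul_cancel]
    rfl
  simp_rw [map_sub, h2] at h1
  have h3 := h1.add_const x
  simp only [sub_add_cancel, zero_add] at h3
  exact mem_closure_of_tendsto h3 (Filter.Eventually.of_forall fun n => ⟨n, γ n, rfl⟩)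

/-- If `t` is a period of `H`, so is `A⁻¹ t`: apply the scaling law at `x + A⁻¹ t` and cancel `M`.
The lattice periods thus generate a dense set of periods. -/
theorem ae_const_of_equivariant (hΓ : IsSplittingCrystalGroup Γ) {A : Euc d ≃ₗ[ℝ] Euc d}
    (hA : IsExpansive A.toLinearMap) {m : Type*} [Fintype m] [DecidableEq m] (M M' : Matrix m m ℂ)
    (hM : M' * M = 1) (H : Euc d → m → ℂ) (hH : ∀ α, LocallyIntegrable fun x => H x α)
    (hper : ∀ τ : Γ, τ.1.linear = LinearEquiv.refl ℝ _ → ∀ᵐ x : Euc d, H (τ.1⁻¹ x) = H x)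
    (hscale : ∀ᵐ x : Euc d, H (A x) = M *ᵥ H x) :
    ∃ u : m → ℂ, ∀ᵐ x : Euc d, H x = u := by
  have h0 : ∀ γ : Γ, ∀ᵐ x : Euc d, H (x + γ.1 0) = H x := by
    intro γ
    obtain ⟨τ, hτ, hx⟩ := hΓ.translation_mem γ
    have h1 := (measurePreserving_add_right (volume : Measure (Euc d))
      (γ.1 0)).quasiMeasurePreserving.ae (hper τ hτ)
    filter_upwards [h1] with x h
    rw [← h, ← hx]
    congr 1
    exact τ.1.symm_apply_apply x
  have h1 : ∀ (n : ℕ) (γ : Γ), ∀ᵐ x : Euc d,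
      H (x + (A.symm ^ n : Euc d ≃ₗ[ℝ] Euc d) (γ.1 0)) = H x := by
    intro n γ
    induction n with
    | zero => simpa using h0 γ
    | succ n ih =>
      have h2 := (measurePreserving_add_right (volume : Measure (Euc d))
        ((A.symm ^ (n + 1) : Euc d ≃ₗ[ℝ] Euc d) (γ.1 0))).quasiMeasurePreserving.ae hscale
      have h3 := (quasiMeasurePreserving_linearEquiv A).ae ih
      filter_upwards [hscale, h2, h3] with x hx hx2 hx3
      rw [map_add, pow_succ', LinearEquiv.mul_apply, LinearEquiv.apply_symm_apply, hx3, hx] at hx2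
      have h4 := congrArg (M' *ᵥ ·) hx2
      simp only [Matrix.mulVec_mulVec, hM, Matrix.one_mulVec] at h4
      rw [h4, pow_succ', LinearEquiv.mul_apply]
  have h2 : ∀ α, ∃ c : ℂ, ∀ᵐ x : Euc d, H x α = c := by
    intro α
    refine ae_const_of_dense_periods (hH α) (dense_symm_pow_orbit hΓ.toIsCrystalGroup hA) ?_
    rintro _ ⟨n, γ, rfl⟩
    filter_upwards [h1 n γ] with x hx
    rw [hx]
  choose u hu using h2
  refine ⟨u, ?_⟩
  filter_upwards [ae_all_iff.2 hu] with x hx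
  exact funext hx

/-! ### The representation of the monomials -/

/-- The vector function `G_[s] = ∑_γ y_[s](γ) f(γ x)`. -/
noncomputable def accVec (Γ : Subgroup (Aff d)) (f : Euc d → Fin r → ℂ)
    (v : (Fin d →₀ ℕ) → Fin r → ℂ) (s : ℕ) (x : Euc d) : MultiIdx d s → ℂ :=
  fun α => translateSum Γ f (fun γ => yMat v s γ.1 α) x

theorem translateSum_sum_mul_row (hΓ : IsCrystalGroup Γ) (hf : HasCompactSupport f) {s p : ℕ}
    (Q : ∀ t, Matrix (MultiIdx d s) (MultiIdx d t) ℂ) (Y : ∀ t, Γ → Matrix (MultiIdx d t) (Fin r) ℂ)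
    (x : Euc d) (α : MultiIdx d s) :
    translateSum Γ f (fun γ => (∑ t ∈ Finset.range p, Q t * Y t γ) α) x =
      (∑ t ∈ Finset.range p, Q t *ᵥ fun β => translateSum Γ f (fun γ => Y t γ β) x) α := by
  have h : (fun γ => (∑ t ∈ Finset.range p, Q t * Y t γ) α) =
      fun γ => ∑ t ∈ Finset.range p, Q t α ᵥ* Y t γ := by
    funext γ
    refine (Finset.sum_apply α _ _).trans (Finset.sum_congr rfl fun t _ => ?_)
    exact Matrix.mul_apply_eq_vecMul _ _ _
  rw [h, translateSum_sum hΓ hf, Finset.sum_apply]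
  exact Finset.sum_congr rfl fun t _ => translateSum_matrix_row hΓ hf _ _ x

theorem accVec_inv_apply (hΓ : IsCrystalGroup Γ) (hf : HasCompactSupport f) {s p : ℕ} (hs : s < p)
    (v : (Fin d →₀ ℕ) → Fin r → ℂ) (σ : Γ) (x : Euc d) :
    accVec Γ f v s (σ.1⁻¹ x) =
      ∑ t ∈ Finset.range p, crystalMat s t σ.1 *ᵥ accVec Γ f v t x := by
  funext α
  have h : (fun γ : Γ => yMat v s (γ * σ).1 α) =
      fun γ : Γ => (∑ t ∈ Finset.range p, crystalMat s t σ.1 * yMat v t γ.1) α := by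
    funext γ
    rw [Subgroup.coe_mul, yMat_mul hs]
  rw [accVec, translateSum_inv_apply, h,
    translateSum_sum_mul_row hΓ hf _ (fun t (γ : Γ) => yMat v t γ.1)]
  rfl

theorem translateSum_mul_finsum_row (hΓ : IsCrystalGroup Γ) (hf : HasCompactSupport f)
    (A : Euc d ≃ₗ[ℝ] Euc d) (c : Aff d →₀ Matrix (Fin r) (Fin r) ℂ) {m : Type*} [Fintype m]
    (M : Matrix m m ℂ) (Y : Γ → Matrix m (Fin r) ℂ) (x : Euc d) (α : m) :
    translateSum Γ f (fun σ => (M * ∑ᶠ γ : Γ, Y γ * refMat A c γ.1 σ.1) α) x =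
      (M *ᵥ fun β => translateSum Γ f (rowMulRefMat Γ A c fun γ => Y γ β) x) α := by
  have h : (fun σ : Γ => (M * ∑ᶠ γ : Γ, Y γ * refMat A c γ.1 σ.1) α) =
      fun σ : Γ => M α ᵥ* ∑ᶠ γ : Γ, Y γ * refMat A c γ.1 σ.1 := by
    funext σ
    exact Matrix.mul_apply_eq_vecMul _ _ _
  rw [h, translateSum_matrix_row hΓ hf]
  simp_rw [finsum_mul_refMat_apply]
  rfl

theorem accVec_scale (hΓ : IsCrystalGroup Γ) {A : Euc d ≃ₗ[ℝ] Euc d} (hA : IsAdmissible Γ A)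
    {c : Aff d →₀ Matrix (Fin r) (Fin r) ℂ} (hf : HasCompactSupport f)
    (href : IsRefinable Γ A c f) {v : (Fin d →₀ ℕ) → Fin r → ℂ} {s : ℕ}
    (heig : ∀ σ : Γ,
      yMat v s σ.1 = powMat A.toLinearMap s * ∑ᶠ γ : Γ, yMat v s γ.1 * refMat A c γ.1 σ.1) :
    ∀ᵐ x : Euc d, accVec Γ f v s (A x) = powMat A.toLinearMap s *ᵥ accVec Γ f v s x := by
  filter_upwards [translateSum_refine hΓ hA hf href] with x hx
  funext α
  have h : (fun σ : Γ => yMat v s σ.1 α) = fun σ : Γ =>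
      (powMat A.toLinearMap s * ∑ᶠ γ : Γ, yMat v s γ.1 * refMat A c γ.1 σ.1) α :=
    funext fun σ => by rw [← heig σ]
  rw [accVec, h, translateSum_mul_finsum_row hΓ hf A c _ (fun γ : Γ => yMat v s γ.1)]
  simp_rw [← hx]
  rfl

theorem accVec_ae_eq_monoVec {p : ℕ} (hΓ : IsSplittingCrystalGroup Γ)
    {A : Euc d ≃ₗ[ℝ] Euc d} (hA : IsAdmissible Γ A) {c : Aff d →₀ Matrix (Fin r) (Fin r) ℂ}
    (hf_int : Integrable f) (hf : HasCompactSupport f) (href : IsRefinable Γ A c f)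
    {v : (Fin d →₀ ℕ) → Fin r → ℂ}
    (heig : ∀ s < p, ∀ σ : Γ,
      yMat v s σ.1 = powMat A.toLinearMap s * ∑ᶠ γ : Γ, yMat v s γ.1 * refMat A c γ.1 σ.1)
    {P : Set (Euc d)} (hP : IsFundDomain Γ P) (hv : v 0 ⬝ᵥ 𝓕 f 0 = ((volume P).toReal : ℂ)) :
    ∀ s < p, ∀ᵐ x : Euc d, accVec Γ f v s x = monoVec s x := by
  classical
  have hΓ' := hΓ.toIsCrystalGroup
  intro s
  induction s using Nat.strong_induction_on with
  | _ s ih =>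
    intro hs
    have ih' : ∀ᵐ x : Euc d, ∀ t, t < s → accVec Γ f v t x = monoVec t x := by
      rw [ae_all_iff]
      intro t
      by_cases ht : t < s
      · filter_upwards [ih t ht (ht.trans hs)] with x hx _ using hx
      · exact Filter.Eventually.of_forall fun x h => absurd h ht
    have hloc : ∀ α : MultiIdx d s, LocallyIntegrable fun x : Euc d =>
        (accVec Γ f v s x - monoVec s x) α := fun α =>
      (locallyIntegrable_translateSum hΓ' hf_int hf _).sub
        ((continuous_apply α).comp (continuous_monoVec s)).locallyIntegrable
    have hscale : ∀ᵐ x : Euc d, accVec Γ f v s (A x) - monoVec s (A x) =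
        powMat A.toLinearMap s *ᵥ (accVec Γ f v s x - monoVec s x) := by
      filter_upwards [accVec_scale hΓ' hA hf href (heig s hs)] with x hx
      rw [hx, Matrix.mulVec_sub, ← monoVec_map, LinearEquiv.coe_coe]
    -- Under a translation the lower-degree terms of `G` and `X` cancel by induction, and the
    -- diagonal block is the identity.
    have hper : ∀ τ : Γ, τ.1.linear = LinearEquiv.refl ℝ _ → ∀ᵐ x : Euc d,
        accVec Γ f v s (τ.1⁻¹ x) - monoVec s (τ.1⁻¹ x) = accVec Γ f v s x - monoVec s x := by
      intro τ hτ
      filter_upwards [ih'] with x hx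
      rw [accVec_inv_apply hΓ' hf hs, monoVec_inv_apply hs, ← Finset.sum_sub_distrib,
        Finset.sum_eq_single s, crystalMat_self_of_linear_eq s _ hτ, Matrix.one_mulVec,
        Matrix.one_mulVec]
      · intro t _ hts
        rcases lt_or_gt_of_ne hts with h | h
        · rw [hx t h, sub_self]
        · rw [crystalMat_eq_zero h, Matrix.zero_mulVec, Matrix.zero_mulVec, sub_self]
      · exact fun h => absurd (Finset.mem_range.2 hs) h
    have hinv : powMat A.symm.toLinearMap s * powMat A.toLinearMap s = 1 := by
      rw [powMat_mul_powMat, ← powMat_id]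
      congr 1
      ext x : 1
      simp
    obtain ⟨u, hu⟩ := ae_const_of_equivariant hΓ hA.expansive _ _ hinv
      (fun x => accVec Γ f v s x - monoVec s x) hloc hper hscale
    suffices hu0 : u = 0 by
      filter_upwards [hu] with x hx
      rwa [hu0, sub_eq_zero] at hx
    rcases eq_or_ne s 0 with rfl | hs0
    · funext α
      -- For `s = 0` the scaling law says nothing about the constant; the normalization `v_0 f̂(0) =
      -- |P|` and integration over `P` determine it.
      have h1 : ∀ᵐ x : Euc d, translateSum Γ f (fun _ => v 0) x = 1 + u α := by
        filter_upwards [hu] with x hx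
        have := congrFun hx α
        rw [monoVec_zero, Pi.sub_apply, Pi.one_apply, accVec, sub_eq_iff_eq_add'] at this
        simpa only [yMat_zero] using this
      have h2 := setIntegral_translateSum_const hΓ' hf_int hf hP (v 0)
      rw [integral_congr_ae (ae_restrict_of_ae h1), setIntegral_const, hv, measureReal_def,
        Complex.real_smul] at h2
      have h3 : ((volume P).toReal : ℂ) ≠ 0 := by
        rw [Complex.ofReal_ne_zero]
        exact (ENNReal.toReal_pos (hP.volume_pos hΓ').ne' hP.isCompact.measure_lt_top.ne).ne'
      have h4 := mul_left_cancel₀ h3 (h2.trans (mul_one _).symm)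
      simpa using h4
    · refine eq_zero_of_powMat_mulVec_eq hs0 A hA.expansive.tendsto_symm_pow u ?_
      obtain ⟨x, hx1, hx2, hx3⟩ :=
        (hu.and (((quasiMeasurePreserving_linearEquiv A).ae hu).and hscale)).exists
      rw [hx1, hx2] at hx3
      exact hx3.symm

/-! ### Functions in the closure are infinite combinations of translates -/

theorem integrable_test_mul (φ : CompactlySupportedContinuousMap (Euc d) ℂ) {g : Euc d → ℂ}
    (hg : LocallyIntegrable g) : Integrable fun x => φ x * g x :=
  hg.integrable_smul_left_of_hasCompactSupport φ.continuous φ.hasCompactSupport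

/-- The linear form `φ ↦ ∫ φ g` on continuous functions with compact support. -/
noncomputable def testPairing {g : Euc d → ℂ} (hg : LocallyIntegrable g) :
    CompactlySupportedContinuousMap (Euc d) ℂ →ₗ[ℂ] ℂ where
  toFun φ := ∫ x, φ x * g x
  map_add' φ ψ := by
    rw [← integral_add (integrable_test_mul φ hg) (integrable_test_mul ψ hg)]
    simp [add_mul]
  map_smul' w φ := by
    rw [RingHom.id_apply, smul_eq_mul, ← integral_const_mul]
    simp [mul_assoc]

theorem locallyIntegrable_of_mem_finiteSpan (hΓ : IsCrystalGroup Γ) (hf : Integrable f)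
    {h : Euc d → ℂ} (hh : h ∈ finiteSpan Γ f) : LocallyIntegrable h := by
  induction hh using Submodule.span_induction with
  | mem h hh =>
    obtain ⟨γ, hγ, b, rfl⟩ := hh
    exact (hΓ.integrable_dotProduct hf ⟨γ, hγ⟩ b).locallyIntegrable
  | zero => exact locallyIntegrable_zero
  | add h h' _ _ ih ih' => exact ih.add ih'
  | smul w h _ ih => exact ih.smul w

theorem integral_test_mul_finiteSpan (hΓ : IsCrystalGroup Γ) (hf : Integrable f)
    (φ : CompactlySupportedContinuousMap (Euc d) ℂ)
    (hφ : ∀ (γ : Γ) (i : Fin r), ∫ x, φ x * f (γ.1 x) i = 0)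
    {h : Euc d → ℂ} (hh : h ∈ finiteSpan Γ f) : ∫ x, φ x * h x = 0 := by
  induction hh using Submodule.span_induction with
  | mem h hh =>
    obtain ⟨γ, hγ, b, rfl⟩ := hh
    have e : (fun x => φ x * (b ⬝ᵥ f (γ x))) = fun x => ∑ i, b i * (φ x * f (γ x) i) := by
      funext x
      rw [dotProduct, Finset.mul_sum]
      exact Finset.sum_congr rfl fun i _ => by ring
    rw [e, integral_finsetSum]
    · refine Finset.sum_eq_zero fun i _ => ?_
      rw [integral_const_mul, hφ ⟨γ, hγ⟩ i, mul_zero]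
    · exact fun i _ => (integrable_test_mul φ
        (hΓ.integrable_apply hf ⟨γ, hγ⟩ i).locallyIntegrable).const_mul _
  | zero => simp
  | add h h' hh hh' ih ih' =>
    simp only [Pi.add_apply, mul_add]
    rw [integral_add (integrable_test_mul φ (locallyIntegrable_of_mem_finiteSpan hΓ hf hh))
      (integrable_test_mul φ (locallyIntegrable_of_mem_finiteSpan hΓ hf hh')), ih, ih', add_zero]
  | smul w h _ ih =>
    simp only [Pi.smul_apply, smul_eq_mul, mul_left_comm _ w]
    rw [integral_const_mul, ih, mul_zero]

theorem integral_test_mul_memS (hΓ : IsCrystalGroup Γ) (hf : Integrable f)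
    (φ : CompactlySupportedContinuousMap (Euc d) ℂ)
    (hφ : ∀ (γ : Γ) (i : Fin r), ∫ x, φ x * f (γ.1 x) i = 0)
    {q : Euc d → ℂ} (hq : LocallyIntegrable q) (hS : MemS Γ f q) : ∫ x, φ x * q x = 0 := by
  obtain ⟨M, hM⟩ := φ.hasCompactSupport.exists_bound_of_continuous φ.continuous
  by_contra hne
  set X : ℝ≥0∞ := ‖∫ x, φ x * q x‖ₑ with hX
  have hX0 : X ≠ 0 := by simpa [hX] using hne
  -- The `+ 1` keeps the divisor nonzero when the bound for `φ` is zero.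
  set N : ℝ≥0∞ := ENNReal.ofReal M + 1 with hN
  have hN0 : N ≠ 0 := by simp [hN]
  have hNt : N ≠ ∞ := by simp [hN]
  obtain ⟨h, hh, hlt⟩ := hS _ φ.hasCompactSupport.isCompact (X / N)
    (ENNReal.div_pos hX0 hNt)
  have hloc := locallyIntegrable_of_mem_finiteSpan hΓ hf hh
  have h1 : ∫ x, φ x * q x = ∫ x, φ x * (q x - h x) := by
    simp only [mul_sub]
    rw [integral_sub (integrable_test_mul φ hq) (integrable_test_mul φ hloc),
      integral_test_mul_finiteSpan hΓ hf φ hφ hh, sub_zero]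
  have h2 : X ≤ N * ∫⁻ x in tsupport φ, ‖q x - h x‖ₑ := by
    rw [hX, h1, ← lintegral_const_mul' _ _ hNt,
      ← lintegral_indicator (isClosed_tsupport φ).measurableSet]
    refine (enorm_integral_le_lintegral_enorm _).trans (lintegral_mono fun x => ?_)
    by_cases hx : x ∈ tsupport φ
    · rw [Set.indicator_of_mem hx, enorm_mul]
      refine mul_le_mul_left ?_ _
      rw [← ofReal_norm]
      exact (ENNReal.ofReal_le_ofReal (hM x)).trans le_self_add
    · rw [image_eq_zero_of_notMem_tsupport hx]
      simp
  have h3 := (ENNReal.lt_div_iff_mul_lt (Or.inl hN0) (Or.inl hNt)).1 hlt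
  rw [mul_comm] at h3
  exact absurd h3 (not_lt.2 h2)

/-- Let `T φ` be the family of all pairings of a test function `φ` with the components of translates
of `f`. The form `φ ↦ ∫ φ q` kills `ker T`, because `q` is in the closure, hence it factors as `β ∘
T` by pure linear algebra. The values of `β` on unit vectors are the coefficients. -/
theorem exists_translateSum_eq (hΓ : IsCrystalGroup Γ) (hf_int : Integrable f)
    (hf : HasCompactSupport f) {q : Euc d → ℂ} (hq : LocallyIntegrable q) (hS : MemS Γ f q) :
    ∃ b : Γ → Fin r → ℂ, ∀ᵐ x : Euc d, q x = translateSum Γ f b x := by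
  classical
  let T : CompactlySupportedContinuousMap (Euc d) ℂ →ₗ[ℂ] (Γ × Fin r → ℂ) :=
    LinearMap.pi fun z => testPairing (hΓ.integrable_apply hf_int z.1 z.2).locallyIntegrable
  have hT : ∀ φ z, T φ z = ∫ x, φ x * f (z.1.1 x) z.2 := fun _ _ => rfl
  have hmem : testPairing hq ∈ (LinearMap.ker T).dualAnnihilator := by
    rw [Submodule.mem_dualAnnihilator]
    intro φ hφ
    refine integral_test_mul_memS hΓ hf_int φ (fun γ i => ?_) hq hS
    rw [← hT φ (γ, i), LinearMap.mem_ker.1 hφ, Pi.zero_apply]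
  rw [← LinearMap.range_dualMap_eq_dualAnnihilator_ker] at hmem
  obtain ⟨β, hβ⟩ := hmem
  refine ⟨fun γ i => β (Pi.single (γ, i) 1), ?_⟩
  set b : Γ → Fin r → ℂ := fun γ i => β (Pi.single (γ, i) 1) with hb
  have key : ∀ φ : CompactlySupportedContinuousMap (Euc d) ℂ,
      ∫ x, φ x * q x = ∫ x, φ x * translateSum Γ f b x := by
    intro φ
    obtain ⟨R, hR⟩ := φ.hasCompactSupport.isCompact.isBounded.exists_norm_le
    obtain ⟨S, hS⟩ := hΓ.exists_finset hf R
    have h1 : ∀ x, φ x * translateSum Γ f b x =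
        ∑ z ∈ S ×ˢ Finset.univ, b z.1 z.2 * (φ x * f (z.1.1 x) z.2) := by
      intro x
      rw [Finset.sum_product]
      by_cases hx : x ∈ tsupport φ
      · rw [translateSum_eq_sum (hS x (hR x hx)), Finset.mul_sum]
        refine Finset.sum_congr rfl fun γ _ => ?_
        rw [dotProduct, Finset.mul_sum]
        exact Finset.sum_congr rfl fun i _ => by ring
      · simp [image_eq_zero_of_notMem_tsupport hx]
    -- Unit vectors do not span the full product in general, but `T φ` has finite support because
    -- `φ` has compact support, so `β (T φ)` is determined by them.
    have h2 : T φ = ∑ z ∈ S ×ˢ Finset.univ, T φ z • Pi.single z (1 : ℂ) := by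
      funext z
      rw [Finset.sum_apply]
      by_cases hz : z.1 ∈ S
      · rw [Finset.sum_eq_single z]
        · simp
        · intro z' _ hne
          simp [hne.symm]
        · intro h
          exact absurd (by simpa using hz) h
      · rw [Finset.sum_eq_zero, hT]
        · rw [integral_eq_zero_of_ae]
          refine Filter.Eventually.of_forall fun x => ?_
          by_cases hx : x ∈ tsupport φ
          · simp [hS x (hR x hx) z.1 hz]
          · simp [image_eq_zero_of_notMem_tsupport hx]
        · intro z' hz'
          have : z ≠ z' := by
            rintro rfl
            exact hz (Finset.mem_product.1 hz').1
          simp [this]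
    have h3 : ∫ x, φ x * q x = β (T φ) := (LinearMap.congr_fun hβ φ).symm
    rw [h3, h2, map_sum]
    simp_rw [h1]
    rw [integral_finsetSum]
    · refine Finset.sum_congr rfl fun z _ => ?_
      rw [integral_const_mul, map_smul, smul_eq_mul, mul_comm, hT]
    · exact fun z _ => (integrable_test_mul φ
        (hΓ.integrable_apply hf_int z.1 z.2).locallyIntegrable).const_mul _
  refine ae_eq_of_integral_contDiff_smul_eq hq
    (locallyIntegrable_translateSum hΓ hf_int hf b) fun g hg hgs => ?_
  let φ : CompactlySupportedContinuousMap (Euc d) ℂ :=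
    { toFun := fun x => (g x : ℂ)
      continuous_toFun := Complex.continuous_ofReal.comp hg.continuous
      hasCompactSupport' := hgs.comp_left Complex.ofReal_zero }
  simp only [Complex.real_smul]
  exact key φ

end

/-! ### Accuracy -/

section

variable {d r p : ℕ} {Γ : Subgroup (Aff d)} {f : Euc d → Fin r → ℂ}

theorem translateSum_mem_finiteSpan {S : Finset Γ} (b : Γ → Fin r → ℂ) :
    (fun x => ∑ γ ∈ S, b γ ⬝ᵥ f (γ.1 x)) ∈ finiteSpan Γ f := by
  have h : (fun x => ∑ γ ∈ S, b γ ⬝ᵥ f (γ.1 x)) = ∑ γ ∈ S, fun x => b γ ⬝ᵥ f (γ.1 x) := by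
    funext x
    rw [Finset.sum_apply]
  rw [h]
  exact Submodule.sum_mem _ fun γ _ => Submodule.subset_span ⟨γ.1, γ.2, b γ, rfl⟩

theorem memS_of_ae_eq_translateSum (hΓ : IsCrystalGroup Γ) (hf : HasCompactSupport f)
    {q : Euc d → ℂ} {b : Γ → Fin r → ℂ} (h : ∀ᵐ x : Euc d, q x = translateSum Γ f b x) :
    MemS Γ f q := by
  intro K hK ε hε
  obtain ⟨R, hR⟩ := hK.isBounded.exists_norm_le
  obtain ⟨S, hS⟩ := hΓ.exists_finset hf R
  -- On `K` the truncated sum equals the infinite one, so the error is exactly zero.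
  refine ⟨_, translateSum_mem_finiteSpan (S := S) b, ?_⟩
  rw [lintegral_eq_zero_of_ae_eq_zero]
  · exact hε
  · filter_upwards [ae_restrict_of_ae h, ae_restrict_mem hK.measurableSet] with x hx hxK
    rw [hx, translateSum_eq_sum (hS x (hR x hxK)), sub_self, enorm_zero, Pi.zero_apply]

theorem hasAccuracy_of_ae_eq_monoVec (hΓ : IsCrystalGroup Γ) (hf : HasCompactSupport f)
    {v : (Fin d →₀ ℕ) → Fin r → ℂ}
    (h : ∀ s < p, ∀ᵐ x : Euc d, accVec Γ f v s x = monoVec s x) : HasAccuracy Γ f p := by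
  intro q hq
  refine memS_of_ae_eq_translateSum hΓ hf (b := fun γ => ∑ t ∈ Finset.range (q.totalDegree + 1),
    ∑ β : MultiIdx d t, MvPolynomial.coeff β.1 q • yMat v t γ.1 β) ?_
  have h' : ∀ᵐ x : Euc d, ∀ s, s < p → accVec Γ f v s x = monoVec s x := by
    rw [ae_all_iff]
    intro s
    by_cases hs : s < p
    · filter_upwards [h s hs] with x hx _ using hx
    · exact Filter.Eventually.of_forall fun x h0 => absurd h0 hs
  filter_upwards [h'] with x hx
  rw [eval_eq_sum_monoVec q _ le_rfl, translateSum_sum hΓ hf]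
  refine Finset.sum_congr rfl fun t ht => ?_
  rw [translateSum_sum hΓ hf]
  refine Finset.sum_congr rfl fun β _ => ?_
  rw [translateSum_smul hΓ hf, ← hx t (by have := Finset.mem_range.1 ht; omega)]
  rfl

theorem HasAccuracy.memS_monoVec (h : HasAccuracy Γ f p) {s : ℕ} (hs : s < p)
    (α : MultiIdx d s) : MemS Γ f fun x => monoVec s x α := by
  have h1 := h (MvPolynomial.monomial α.1 1) (by
    rw [MvPolynomial.totalDegree_monomial _ one_ne_zero]
    refine lt_of_eq_of_lt ?_ hs
    refine Eq.trans ?_ α.2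
    rw [Finsupp.degree_eq_sum, Finsupp.sum_fintype _ _ fun _ => rfl])
  convert h1 using 2 with x
  rw [MvPolynomial.eval_monomial, Finsupp.prod_fintype _ _ (by simp), one_mul]
  rfl

theorem IndependentTranslates.eq_of_ae_eq (hΓ : IsCrystalGroup Γ) (hf : HasCompactSupport f)
    (hind : IndependentTranslates Γ f) {b b' : Γ → Fin r → ℂ}
    (h : ∀ᵐ x : Euc d, translateSum Γ f b x = translateSum Γ f b' x) (γ : Γ) : b γ = b' γ := by
  refine sub_eq_zero.1 ((hind fun γ => b γ - b' γ).1 ?_ γ)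
  filter_upwards [h] with x hx
  exact (translateSum_sub hΓ hf b b' x).trans (sub_eq_zero.2 hx)

theorem exists_yMat_of_hasAccuracy (hΓ : IsCrystalGroup Γ) (hf_int : Integrable f)
    (hf : HasCompactSupport f) (hind : IndependentTranslates Γ f) (hacc : HasAccuracy Γ f p) :
    ∃ v : (Fin d →₀ ℕ) → Fin r → ℂ,
      ∀ s < p, ∀ᵐ x : Euc d, accVec Γ f v s x = monoVec s x := by
  have hex : ∀ s (α : MultiIdx d s), ∃ b : Γ → Fin r → ℂ, s < p →
      ∀ᵐ x : Euc d, monoVec s x α = translateSum Γ f b x := by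
    intro s α
    by_cases hs : s < p
    · obtain ⟨b, hb⟩ := exists_translateSum_eq hΓ hf_int hf
        ((continuous_apply α).comp (continuous_monoVec s)).locallyIntegrable
        (hacc.memS_monoVec hs α)
      exact ⟨b, fun _ => hb⟩
    · exact ⟨0, fun h => absurd h hs⟩
  choose b hb using hex
  let Z : ∀ s, Γ → Matrix (MultiIdx d s) (Fin r) ℂ := fun s γ => Matrix.of fun α => b s α γ
  have hZ : ∀ᵐ x : Euc d, ∀ s, s < p → ∀ α : MultiIdx d s,
      translateSum Γ f (fun γ => Z s γ α) x = monoVec s x α := by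
    rw [ae_all_iff]
    intro s
    by_cases hs : s < p
    · filter_upwards [ae_all_iff.2 fun α => hb s α hs] with x hx _ α
      exact (hx α).symm
    · exact Filter.Eventually.of_forall fun x h0 => absurd h0 hs
  -- At the identity `y_[s](1) = v_[s]`, so the `v_α` can only be the coefficients at `γ = 1`.
  refine ⟨fun α => b α.degree ⟨α, rfl⟩ 1, fun s hs => ?_⟩
  have hy : ∀ t, Matrix.of (fun α : MultiIdx d t => b α.1.degree ⟨α.1, rfl⟩ 1) = Z t 1 := by
    intro t
    ext ⟨α, rfl⟩ i
    rfl
  have hcov : ∀ (σ : Γ) (α : MultiIdx d s), Z s σ α =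
      (∑ t ∈ Finset.range p, crystalMat s t σ.1 * Z t 1) α := by
    intro σ α
    -- Both families represent `X_[s](σ⁻¹ x)`, so they coincide; the claim is their equality at `γ =
    -- 1`.
    have h1 := hind.eq_of_ae_eq hΓ hf (b := fun γ => Z s (γ * σ) α)
      (b' := fun γ => (∑ t ∈ Finset.range p, crystalMat s t σ.1 * Z t γ) α) ?_ 1
    · rwa [one_mul] at h1
    · have h2 := (hΓ.measurePreserving σ⁻¹).quasiMeasurePreserving.ae hZ
      filter_upwards [hZ, h2] with x hx hx2
      rw [translateSum_sum_mul_row hΓ hf,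
        ← translateSum_inv_apply (fun γ => Z s γ α) σ x]
      refine (hx2 s hs α).trans ?_
      rw [Subgroup.coe_inv, monoVec_inv_apply hs, Finset.sum_apply, Finset.sum_apply]
      refine Finset.sum_congr rfl fun t ht => ?_
      congr 2
      exact funext fun β => (hx t (Finset.mem_range.1 ht) β).symm
  filter_upwards [hZ] with x hx
  funext α
  rw [← hx s hs α, accVec]
  congr 1
  funext γ
  rw [hcov γ α, yMat_eq_sum hs]
  simp_rw [hy]

theorem accuracyCondition_of_ae_eq_monoVec (hp : 0 < p) (hΓ : IsCrystalGroup Γ)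
    {A : Euc d ≃ₗ[ℝ] Euc d} (hA : IsAdmissible Γ A) {c : Aff d →₀ Matrix (Fin r) (Fin r) ℂ}
    (hf_int : Integrable f) (hf : HasCompactSupport f) (href : IsRefinable Γ A c f)
    (hind : IndependentTranslates Γ f) {v : (Fin d →₀ ℕ) → Fin r → ℂ}
    (hv : ∀ s < p, ∀ᵐ x : Euc d, accVec Γ f v s x = monoVec s x) :
    AccuracyCondition Γ A c f p v where
  nonzero := by
    obtain ⟨P, hP⟩ := hΓ.exists_fundDomain
    have h1 : ∀ᵐ x : Euc d, translateSum Γ f (fun _ => v 0) x = 1 := by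
      filter_upwards [hv 0 hp] with x hx
      have := congrFun hx ⟨0, map_zero _⟩
      rw [monoVec_zero, Pi.one_apply, accVec] at this
      simpa only [yMat_zero] using this
    rw [← setIntegral_translateSum_const hΓ hf_int hf hP, integral_congr_ae (ae_restrict_of_ae h1),
      setIntegral_const, measureReal_def, Complex.real_smul, mul_one, Complex.ofReal_ne_zero]
    exact (ENNReal.toReal_pos (hP.volume_pos hΓ).ne' hP.isCompact.measure_lt_top.ne).ne'
  eigen s hs σ := by
    funext α
    refine hind.eq_of_ae_eq hΓ hf (b := fun σ : Γ => yMat v s σ.1 α) (b' := fun σ : Γ =>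
      (powMat A.toLinearMap s * ∑ᶠ γ : Γ, yMat v s γ.1 * refMat A c γ.1 σ.1) α) ?_ σ
    -- The refinement identity is used at `A⁻¹ x`, so that `Y L` appears as a combination of
    -- translates at `x` and represents `X_[s](A⁻¹ x)`.
    have h1 := (quasiMeasurePreserving_linearEquiv A.symm).ae
      ((hv s hs).and (translateSum_refine hΓ hA hf href))
    filter_upwards [hv s hs, h1] with x hx hx2
    have hx3 : monoVec s x = powMat A.toLinearMap s *ᵥ monoVec s (A.symm x) := by
      rw [← monoVec_map, LinearEquiv.coe_coe, A.apply_symm_apply]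
    rw [translateSum_mul_finsum_row hΓ hf A c _ (fun γ : Γ => yMat v s γ.1)]
    refine (congrFun (hx.trans hx3) α).trans ?_
    congr 2
    rw [← hx2.1]
    funext β
    have := hx2.2 fun γ : Γ => yMat v s γ.1 β
    rwa [A.apply_symm_apply] at this

end

end CrystalAccuracy

/-! ### Assembly of the two implications -/

theorem theorem4p3 {d r p : ℕ} (hd : 0 < d) (hp : 0 < p)
    (Γ : Subgroup (CrystalAccuracy.Aff d)) (hΓ : CrystalAccuracy.IsSplittingCrystalGroup Γ)
    (A : CrystalAccuracy.Euc d ≃ₗ[ℝ] CrystalAccuracy.Euc d)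
    (hA : CrystalAccuracy.IsAdmissible Γ A)
    (c : CrystalAccuracy.Aff d →₀ Matrix (Fin r) (Fin r) ℂ)
    (f : CrystalAccuracy.Euc d → Fin r → ℂ)
    (hf_int : Integrable f) (hf_supp : HasCompactSupport f)
    (hf_ref : CrystalAccuracy.IsRefinable Γ A c f) :
    (CrystalAccuracy.IndependentTranslates Γ f → CrystalAccuracy.HasAccuracy Γ f p →
      ∃ v : (Fin d →₀ ℕ) → Fin r → ℂ, CrystalAccuracy.AccuracyCondition Γ A c f p v) ∧
    (∀ v : (Fin d →₀ ℕ) → Fin r → ℂ, CrystalAccuracy.AccuracyCondition Γ A c f p v →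
      CrystalAccuracy.HasAccuracy Γ f p ∧
      ∀ P : Set (CrystalAccuracy.Euc d), CrystalAccuracy.IsFundDomain Γ P →
        ∀ C : ℂ, C = (v 0 ⬝ᵥ 𝓕 f 0)⁻¹ * ((volume P).toReal : ℂ) →
          ∀ s < p, ∀ᵐ x : CrystalAccuracy.Euc d,
            CrystalAccuracy.monoVec s x =
              ∑ᶠ γ : Γ, CrystalAccuracy.yMat (fun α => C • v α) s γ.1 *ᵥ f (γ.1 x)) := by
  have hΓ' := hΓ.toIsCrystalGroup
  refine ⟨fun hind hacc => ?_, fun v hv => ?_⟩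
  · obtain ⟨v, hv⟩ :=
      CrystalAccuracy.exists_yMat_of_hasAccuracy hΓ' hf_int hf_supp hind hacc
    exact ⟨v, CrystalAccuracy.accuracyCondition_of_ae_eq_monoVec hp hΓ' hA hf_int hf_supp hf_ref
      hind hv⟩
  · have key : ∀ P : Set (CrystalAccuracy.Euc d), CrystalAccuracy.IsFundDomain Γ P →
        ∀ C : ℂ, C = (v 0 ⬝ᵥ 𝓕 f 0)⁻¹ * ((volume P).toReal : ℂ) →
          ∀ s < p, ∀ᵐ x : CrystalAccuracy.Euc d,
            CrystalAccuracy.accVec Γ f (fun α => C • v α) s x = CrystalAccuracy.monoVec s x := by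
      intro P hP C hC
      -- Condition (ii) is linear in the `v_α`, so it survives multiplication by `C`, which is
      -- chosen to make `v_0 f̂(0)` equal to `|P|`.
      refine CrystalAccuracy.accVec_ae_eq_monoVec hΓ hA hf_int hf_supp hf_ref ?_ hP ?_
      · intro s hs σ
        simp_rw [CrystalAccuracy.yMat_smul, Matrix.smul_mul]
        rw [← smul_finsum, Matrix.mul_smul, ← hv.eigen s hs σ]
      · rw [smul_dotProduct, hC, smul_eq_mul, mul_right_comm, inv_mul_cancel₀ hv.nonzero, one_mul]
    refine ⟨?_, fun P hP C hC s hs => ?_⟩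
    · obtain ⟨P, hP⟩ := hΓ'.exists_fundDomain
      exact CrystalAccuracy.hasAccuracy_of_ae_eq_monoVec hΓ' hf_supp (key P hP _ rfl)
    · filter_upwards [key P hP C hC s hs] with x hx
      rw [← hx]
      funext α
      exact (CrystalAccuracy.finsum_mulVec_apply hΓ' hf_supp _ x α).symm
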